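/- Let $\Omega\subset\mathbb C^n$ be a bounded domain, let $L^2_h(\Omega)$ be the Hilbert space of square-integrable holomorphic functions on $\Omega$ with $\langle f,g\rangle=\int_\Omega f\bar g\,d\lambda$ ($\lambda$ Lebesgue measure), let $K(z)=K(z,z)$ be its Bergman kernel on the diagonal, and let $T_{i\bar j}=\frac{\partial^2}{\partial z_i\partial\bar z_j}\log K$ be the Bergman metric and $\mathrm{Ric}_{i\bar j}=-\frac{\partial^2}{\partial z_i\partial\bar z_j}\log\det(T_{p\bar q})$ its Ricci tensor. Put $$\tilde T_{i\bar j}=(n+1)T_{i\bar j}-\mathrm{Ric}_{i\bar j}.$$ Let $\widetilde{\mathrm{dist}}_\Omega(z,\zeta)$ be the infimum of $\int_0^1\big(\sum_{i,j}\tilde T_{i\bar j}(\gamma(t))\gamma_i'(t)\overline{\gamma_j'(t)}\big)^{1/2}dt$ over all continuous piecewise $C^1$ curves $\gamma:[0,1]\to\Omega$ with $\gamma(0)=z$, $\gamma(1)=\zeta$. Suppose that for all linearly independent $f_0,\dots,f_n\in L^2_h(\Omega)$, every boundary point $z_0\in\partial\Omega$ and every sequence $(z_s)_{s\ge1}$ in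 $\Omega$ with $z_s\to z_0$ in the Euclidean topology, there is a subsequence $(z_{s_k})$ along which the following limit exists and satisfies $$\lim_{k\to\infty}\left.\frac{\left|\det\begin{pmatrix} f_0&\cdots&f_n\\ \frac{\partial f_0}{\partial z_1}&\cdots&\frac{\partial f_n}{\partial z_1}\\ \vdots&\ddots&\vdots\\ \frac{\partial f_0}{\partial z_n}&\cdots&\frac{\partial f_n}{\partial z_n}\end{pmatrix}\right|^2}{K^{n+1}\det\left(\frac{\partial^2}{\partial z_i\partial\bar z_j}\log K\right)}\right|_{z=z_{s_k}}<\det\begin{pmatrix}\langle f_0,f_0\rangle&\cdots&\langle f_n,f_0\rangle\\ \vdots&\ddots&\vdots\\ \langle f_0,f_n\rangle&\cdots&\langle f_n,f_n\rangle\end{pmatrix}.$$ Then $\tilde T$ is complete: every sequence in $\Omega$ that is Cauchy with respect to $\widetilde{\mathrm{dist}}_\Omega$ converges with respect to $\widetilde{\mathrm{dist}}_\Omega$ to a point of $\Omega$. -/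

import Mathlib

open MeasureTheory Set Filter Topology

noncomputable section

namespace BergmanRicci

variable {n : ℕ}

/-! Points of `ℂⁿ` are functions `Fin n → ℂ`, with Lebesgue measure `volume`. The norm of this space
is only used through the topology and the bounded sets, which are the Euclidean ones. -/

/-- The square-integrable holomorphic functions on `Ω` (only the values on `Ω` matter). -/
def IsL2Holomorphic (Ω : Set (Fin n → ℂ)) (f : (Fin n → ℂ) → ℂ) : Prop :=
  DifferentiableOn ℂ f Ω ∧ MemLp f 2 (volume.restrict Ω)

/-- The inner product `⟨f, g⟩ = ∫_Ω f ḡ dλ`, linear in the first argument. -/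
def l2Inner (Ω : Set (Fin n → ℂ)) (f g : (Fin n → ℂ) → ℂ) : ℂ :=
  ∫ z in Ω, f z * starRingEnd ℂ (g z)

/-- `k` represents the evaluation at `w` on the space of square-integrable holomorphic functions. -/
def IsReproducingAt (Ω : Set (Fin n → ℂ)) (w : Fin n → ℂ) (k : (Fin n → ℂ) → ℂ) : Prop :=
  IsL2Holomorphic Ω k ∧ ∀ f, IsL2Holomorphic Ω f → f w = l2Inner Ω f k

open Classical in
/-- The Bergman kernel `K(z, w)` of `Ω`: for `w ∈ Ω`, `K(·, w)` is the square-integrable holomorphic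
function representing the evaluation at `w`; it is unique as a function on `Ω`, and it exists
by the Riesz theorem. -/
def bergmanKernel (Ω : Set (Fin n → ℂ)) (z w : Fin n → ℂ) : ℂ :=
  if h : ∃ k, IsReproducingAt Ω w k then h.choose z else 0

/-- The Bergman kernel on the diagonal, which is real since `K(z, z) = ‖K(·, z)‖²`. -/
def kernelDiag (Ω : Set (Fin n → ℂ)) (z : Fin n → ℂ) : ℝ :=
  (bergmanKernel Ω z z).re

/-- The Wirtinger derivative `∂g/∂z_i = (∂g/∂x_i - i ∂g/∂y_i) / 2`. -/
def dz (i : Fin n) (g : (Fin n → ℂ) → ℂ) (z : Fin n → ℂ) : ℂ :=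
  (fderiv ℝ g z (Pi.single i 1) - Complex.I * fderiv ℝ g z (Pi.single i Complex.I)) / 2

/-- The Wirtinger derivative `∂g/∂z̄_i = (∂g/∂x_i + i ∂g/∂y_i) / 2`. -/
def dzbar (i : Fin n) (g : (Fin n → ℂ) → ℂ) (z : Fin n → ℂ) : ℂ :=
  (fderiv ℝ g z (Pi.single i 1) + Complex.I * fderiv ℝ g z (Pi.single i Complex.I)) / 2

/-- The complex Hessian `(∂²u/∂z_i∂z̄_j)` of a real-valued function `u`. -/
def complexHessian (u : (Fin n → ℂ) → ℝ) (z : Fin n → ℂ) : Matrix (Fin n) (Fin n) ℂ :=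
  Matrix.of fun i j => dz i (dzbar j fun w => (u w : ℂ)) z

/-- The Bergman metric tensor `T = ∂∂̄ log K`. -/
def bergmanMetric (Ω : Set (Fin n → ℂ)) (z : Fin n → ℂ) : Matrix (Fin n) (Fin n) ℂ :=
  complexHessian (fun w => Real.log (kernelDiag Ω w)) z

/-- The determinant of the Bergman metric tensor, which is real since the tensor is Hermitian. -/
def bergmanDet (Ω : Set (Fin n → ℂ)) (z : Fin n → ℂ) : ℝ :=
  (bergmanMetric Ω z).det.re

/-- The Ricci tensor of the Bergman metric, `Ric = -∂∂̄ log det T`. -/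
def ricci (Ω : Set (Fin n → ℂ)) (z : Fin n → ℂ) : Matrix (Fin n) (Fin n) ℂ :=
  -complexHessian (fun w => Real.log (bergmanDet Ω w)) z

/-- The metric tensor `T̃ = (n + 1) T - Ric`. -/
def tildeMetric (Ω : Set (Fin n → ℂ)) (z : Fin n → ℂ) : Matrix (Fin n) (Fin n) ℂ :=
  ((n : ℂ) + 1) • bergmanMetric Ω z - ricci Ω z

/-- The length `(∑ T̃_{ij}(z) X_i X̄_j)^{1/2}` of the vector `X` at the point `z`. -/
def tildeLength (Ω : Set (Fin n → ℂ)) (z X : Fin n → ℂ) : ℝ :=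
  Real.sqrt (∑ i, ∑ j, tildeMetric Ω z i j * X i * starRingEnd ℂ (X j)).re

/-- Continuous piecewise `C¹` curves `[0, 1] → Ω` from `z` to `ζ`: off finitely many break points
the curve is `C¹`, up to the end points of each piece. -/
structure IsCurve (Ω : Set (Fin n → ℂ)) (z ζ : Fin n → ℂ) (γ : ℝ → Fin n → ℂ) : Prop where
  continuousOn : ContinuousOn γ (Icc 0 1)
  piecewise : ∃ S : Finset ℝ, ∀ a b : ℝ, 0 ≤ a → a < b → b ≤ 1 →
    (∀ t ∈ S, t ∉ Ioo a b) → ContDiffOn ℝ 1 γ (Icc a b)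
  mapsTo : MapsTo γ (Icc 0 1) Ω
  source : γ 0 = z
  target : γ 1 = ζ

/-- The distance of `T̃`: the infimum of the lengths of the curves in `Ω` joining two points. -/
def tildeDist (Ω : Set (Fin n → ℂ)) (z ζ : Fin n → ℂ) : ℝ :=
  sInf {L : ℝ | ∃ γ, IsCurve Ω z ζ γ ∧ L = ∫ t in (0 : ℝ)..1, tildeLength Ω (γ t) (deriv γ t)}

/-- Completeness of `T̃`: every Cauchy sequence in `Ω` for its distance has a limit in `Ω`. -/
def TildeComplete (Ω : Set (Fin n → ℂ)) : Prop :=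
  ∀ u : ℕ → Fin n → ℂ, (∀ k, u k ∈ Ω) →
    (∀ ε > 0, ∃ N, ∀ k ≥ N, ∀ l ≥ N, tildeDist Ω (u k) (u l) < ε) →
    ∃ p ∈ Ω, Tendsto (fun k => tildeDist Ω (u k) p) atTop (𝓝 0)

/-- The matrix with first row `f_0(z), …, f_n(z)` and further rows
`∂f_0/∂z_i(z), …, ∂f_n/∂z_i(z)` for `i = 1, …, n`. -/
def jetMatrix (f : Fin (n + 1) → (Fin n → ℂ) → ℂ) (z : Fin n → ℂ) :
    Matrix (Fin (n + 1)) (Fin (n + 1)) ℂ :=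
  Matrix.of fun i j => Fin.cases (f j z) (fun k => fderiv ℂ (f j) z (Pi.single k 1)) i

/-- The Gram determinant `det(⟨f_j, f_i⟩)`, which is real since the matrix is Hermitian. -/
def gramDet (Ω : Set (Fin n → ℂ)) (f : Fin (n + 1) → (Fin n → ℂ) → ℂ) : ℝ :=
  (Matrix.of fun i j => l2Inner Ω (f j) (f i)).det.re

end BergmanRicci

end

/-!
The functions of `L²_h(Ω)` are `⟪k z, g⟫` for a map `k` into a Hilbert space that is antiholomorphic
in `z`. The wedge product `ω(z) = k(z) ∧ ∂₁k(z) ∧ ⋯ ∧ ∂ₙk(z)` satisfies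
`‖ω‖² = Kⁿ⁺¹ det(∂∂̄ log K)`, by a Schur complement in the Gram determinant. Hence
`T̃ = ∂∂̄ log ‖ω‖²` is the pullback of the Fubini–Study form under `z ↦ [ω(z)]`, and the `T̃`-length
of a curve bounds, up to a constant, the variation of the orthogonal projection onto `ℂ ω(z)`. Along
a Cauchy sequence these lines therefore converge. The decomposable vectors form a closed set, so the
limit line is spanned by some `ω₀ = g₀ ∧ ⋯ ∧ gₙ ≠ 0`. For `f_j = ⟪k, g_j⟫` the quotient of the
criterion is the squared norm of the projection of `ω₀` onto `ℂ ω(z)`. It tends to `‖ω₀‖²`, the Gram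
determinant of the `f_j`, so the sequence cannot accumulate at the boundary.
-/

noncomputable section

namespace BergmanRicci

/-! ### Wedge products in Hilbert spaces -/

section Wedge

variable {𝕜 ι H H' E : Type*} [RCLike 𝕜] [DecidableEq ι]
  [NormedAddCommGroup H] [InnerProductSpace 𝕜 H] [NormedAddCommGroup H'] [InnerProductSpace 𝕜 H']
  [NormedAddCommGroup E] [InnerProductSpace 𝕜 E]

variable (𝕜) in
/-- The mixed Gram matrix `(⟨f_a, g_b⟩)` of two families of vectors. -/
def crossGram (f g : ι → H) : Matrix ι ι 𝕜 :=
  Matrix.of fun a b => inner 𝕜 (f a) (g b)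

theorem crossGram_update_left (f g : ι → H) (a : ι) (x : H) :
    crossGram 𝕜 (Function.update f a x) g =
      (crossGram 𝕜 f g).updateRow a fun b => inner 𝕜 x (g b) := by
  ext c b
  rcases eq_or_ne c a with rfl | hc
  · simp [crossGram]
  · simp [crossGram, hc]

theorem crossGram_update_right (f g : ι → H) (a : ι) (x : H) :
    crossGram 𝕜 f (Function.update g a x) =
      (crossGram 𝕜 f g).updateCol a fun b => inner 𝕜 (f b) x := by
  ext b c
  rcases eq_or_ne c a with rfl | hc
  · simp [crossGram]
  · simp [crossGram, hc]

theorem eq_zero_of_mem_span_of_forall_inner_eq_zero {s : Set E} {η : E}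
    (hη : η ∈ Submodule.span 𝕜 s) (h : ∀ x ∈ s, inner 𝕜 x η = 0) : η = 0 := by
  have hspan : Submodule.span 𝕜 s ≤ (𝕜 ∙ η)ᗮ :=
    Submodule.span_le.2 fun x hx => Submodule.mem_orthogonal_singleton_iff_inner_left.2 (h x hx)
  exact inner_self_eq_zero.1 (Submodule.mem_orthogonal_singleton_iff_inner_left.1 (hspan hη))

variable [Fintype ι]

variable (𝕜) in
/-- A map `W` on families of vectors realizes the wedge product `f ↦ ⋀ f_a` if the inner products of
its values are the determinants of the mixed Gram matrices. This makes `W` multilinear and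
continuous. -/
def IsWedge (W : (ι → H) → E) : Prop :=
  ∀ f g, inner 𝕜 (W f) (W g) = (crossGram 𝕜 f g).det

namespace IsWedge

variable {W : (ι → H) → E}

theorem comp_linearIsometry (hW : IsWedge 𝕜 W) (L : H' →ₗᵢ[𝕜] H) :
    IsWedge 𝕜 fun f : ι → H' => W (L ∘ f) :=
  fun f g => by simp only [hW (L ∘ f), crossGram, Function.comp_apply, L.inner_map_map]

theorem map_update_add (hW : IsWedge 𝕜 W) (f : ι → H) (a : ι) (x y : H) :
    W (Function.update f a (x + y)) = W (Function.update f a x) + W (Function.update f a y) := by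
  rw [← sub_eq_zero]
  refine eq_zero_of_mem_span_of_forall_inner_eq_zero (𝕜 := 𝕜) (s := range W) ?_ ?_
  · refine sub_mem ?_ (add_mem ?_ ?_) <;> exact Submodule.subset_span (mem_range_self _)
  · rintro _ ⟨g, rfl⟩
    rw [inner_sub_right, inner_add_right, hW, hW, hW]
    simp_rw [crossGram_update_right, inner_add_right]
    exact sub_eq_zero.2 (Matrix.det_updateCol_add _ _ _ _)

theorem map_update_smul (hW : IsWedge 𝕜 W) (f : ι → H) (a : ι) (c : 𝕜) (x : H) :
    W (Function.update f a (c • x)) = c • W (Function.update f a x) := by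
  rw [← sub_eq_zero]
  refine eq_zero_of_mem_span_of_forall_inner_eq_zero (𝕜 := 𝕜) (s := range W) ?_ ?_
  · refine sub_mem ?_ (Submodule.smul_mem _ _ ?_) <;> exact Submodule.subset_span (mem_range_self _)
  · rintro _ ⟨g, rfl⟩
    rw [inner_sub_right, inner_smul_right, hW, hW]
    simp_rw [crossGram_update_right, inner_smul_right]
    exact sub_eq_zero.2 (Matrix.det_updateCol_smul _ _ _ _)

theorem norm_sub_sq (hW : IsWedge 𝕜 W) (f g : ι → H) :
    ((‖W f - W g‖ ^ 2 : ℝ) : 𝕜) = (crossGram 𝕜 f f).det - (crossGram 𝕜 f g).det -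
      ((crossGram 𝕜 g f).det - (crossGram 𝕜 g g).det) := by
  rw [← hW, ← hW, ← hW, ← hW, RCLike.ofReal_pow, ← inner_self_eq_norm_sq_to_K, inner_sub_left,
    inner_sub_right, inner_sub_right]

theorem continuous (hW : IsWedge 𝕜 W) : Continuous W := by
  refine continuous_iff_continuousAt.2 fun g => tendsto_iff_norm_sub_tendsto_zero.2 ?_
  have hcont : Continuous fun f : ι → H => RCLike.re ((crossGram 𝕜 f f).det -
      (crossGram 𝕜 f g).det - ((crossGram 𝕜 g f).det - (crossGram 𝕜 g g).det)) := by
    have hinner : ∀ {φ ψ : (ι → H) → ι → H}, Continuous φ → Continuous ψ →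
        Continuous fun f => (crossGram 𝕜 (φ f) (ψ f)).det := fun hφ hψ =>
      Continuous.matrix_det <| continuous_matrix fun a b =>
        ((continuous_apply a).comp hφ).inner ((continuous_apply b).comp hψ)
    refine RCLike.continuous_re.comp (((hinner ?_ ?_).sub (hinner ?_ ?_)).sub
      ((hinner ?_ ?_).sub (hinner ?_ ?_))) <;> fun_prop
  have hsq : Tendsto (fun f => ‖W f - W g‖ ^ 2) (𝓝 g) (𝓝 0) := by
    simpa [← hW.norm_sub_sq] using hcont.tendsto g
  simpa [Real.sqrt_sq] using hsq.sqrt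

/-- The continuous multilinear map underlying a wedge product. -/
def toContinuousMultilinearMap (hW : IsWedge 𝕜 W) :
    ContinuousMultilinearMap 𝕜 (fun _ : ι => H) E where
  toMultilinearMap := MultilinearMap.mk' W hW.map_update_add hW.map_update_smul
  cont := hW.continuous

theorem norm_sq (hW : IsWedge 𝕜 W) (f : ι → H) :
    ((‖W f‖ ^ 2 : ℝ) : 𝕜) = (crossGram 𝕜 f f).det := by
  rw [← hW, inner_self_eq_norm_sq_to_K, RCLike.ofReal_pow]

theorem linearIndependent (hW : IsWedge 𝕜 W) {f : ι → H} (hf : W f ≠ 0) :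
    LinearIndependent 𝕜 f :=
  Matrix.linearIndependent_of_det_gram_ne_zero fun h =>
    hf (inner_self_eq_zero.1 ((hW f f).trans h))

theorem apply_linearCombination (hW : IsWedge 𝕜 W) (B : Matrix ι ι 𝕜) (h : ι → H) :
    W (fun a => ∑ b, B b a • h b) = B.det • W h := by
  rw [← sub_eq_zero]
  refine eq_zero_of_mem_span_of_forall_inner_eq_zero (𝕜 := 𝕜) (s := range W) ?_ ?_
  · refine sub_mem ?_ (Submodule.smul_mem _ _ ?_) <;> exact Submodule.subset_span (mem_range_self _)
  · rintro _ ⟨g, rfl⟩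
    have hmul : crossGram 𝕜 g (fun a => ∑ b, B b a • h b) = crossGram 𝕜 g h * B := by
      ext a b
      simp [crossGram, Matrix.mul_apply, inner_sum, inner_smul_right, mul_comm]
    rw [inner_sub_right, inner_smul_right, hW, hW, hmul, Matrix.det_mul, mul_comm, sub_self]

variable [CompleteSpace H] [CompleteSpace E]

/-- The contraction of an element of `E` with the wedge product of all `e_b` for `b ≠ a`: the
adjoint of `x ↦ W (e with e_a replaced by x)`. -/
def contraction (hW : IsWedge 𝕜 W) (e : ι → H) (a : ι) : E →L[𝕜] H :=
  ContinuousLinearMap.adjoint (hW.toContinuousMultilinearMap.toContinuousLinearMap e a)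

theorem inner_contraction (hW : IsWedge 𝕜 W) (e : ι → H) (a : ι) (x : H) (η : E) :
    inner 𝕜 x (hW.contraction e a η) = inner 𝕜 (W (Function.update e a x)) η :=
  ContinuousLinearMap.adjoint_inner_right _ _ _

theorem contraction_apply (hW : IsWedge 𝕜 W) (e h : ι → H) (a : ι) :
    hW.contraction e a (W h) = ∑ b, (crossGram 𝕜 e h).adjugate b a • h b := by
  refine ext_inner_left 𝕜 fun x => ?_
  rw [inner_contraction, hW, crossGram_update_left, ← Matrix.cramer_transpose_apply,
    Matrix.cramer_eq_adjugate_mulVec, ← Matrix.adjugate_transpose, inner_sum]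
  simp [Matrix.mulVec, dotProduct, inner_smul_right]

theorem apply_contraction (hW : IsWedge 𝕜 W) (e h : ι → H) :
    W (fun a => hW.contraction e a (W h)) =
      inner 𝕜 (W e) (W h) ^ (Fintype.card ι - 1) • W h := by
  simp_rw [contraction_apply]
  rw [hW.apply_linearCombination, Matrix.det_adjugate, hW]

-- By continuity `apply_contraction` persists in the closure of the range, where it recovers `ω` up
-- to a nonzero factor from its contractions.
theorem isClosed_range [Nonempty ι] (hW : IsWedge 𝕜 W) : IsClosed (range W) := by
  refine isClosed_of_closure_subset fun ω hω => ?_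
  rcases eq_or_ne ω 0 with rfl | hω0
  · exact ⟨0, hW.toContinuousMultilinearMap.map_zero⟩
  obtain ⟨e, he⟩ : ∃ e, inner 𝕜 (W e) ω ≠ 0 := by
    by_contra! hcon
    have hclosed : IsClosed {η : E | inner 𝕜 η ω = 0} :=
      isClosed_eq (by fun_prop) continuous_const
    exact hω0 (inner_self_eq_zero.1 (closure_minimal (range_subset_iff.2 hcon) hclosed hω))
  have hωe : W (fun a => hW.contraction e a ω) = inner 𝕜 (W e) ω ^ (Fintype.card ι - 1) • ω := by
    have hclosed : IsClosed {η : E | W (fun a => hW.contraction e a η) =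
        inner 𝕜 (W e) η ^ (Fintype.card ι - 1) • η} :=
      isClosed_eq (hW.continuous.comp (by fun_prop)) (by fun_prop)
    exact closure_minimal (range_subset_iff.2 (hW.apply_contraction e)) hclosed hω
  obtain ⟨a⟩ := ‹Nonempty ι›
  set g := fun a => hW.contraction e a ω
  refine ⟨Function.update g a ((inner 𝕜 (W e) ω ^ (Fintype.card ι - 1))⁻¹ • g a), ?_⟩
  rw [hW.map_update_smul, Function.update_eq_self, hωe, inv_smul_smul₀ (pow_ne_zero _ he)]

end IsWedge

end Wedge

section LpWedge

variable {𝕜 α ι : Type*} [RCLike 𝕜] [Fintype ι] [MeasurableSpace α] {μ : Measure α} [SigmaFinite μ]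

theorem memLp_two_pi_prod {f : ι → α → 𝕜} (hf : ∀ a, MemLp (f a) 2 μ) :
    MemLp (fun w : ι → α => ∏ a, f a (w a)) 2 (Measure.pi fun _ => μ) := by
  have hmeas : AEStronglyMeasurable (fun w : ι → α => ∏ a, f a (w a)) (Measure.pi fun _ => μ) :=
    Finset.aestronglyMeasurable_fun_prod _ fun a _ =>
      (hf a).1.comp_quasiMeasurePreserving (Measure.quasiMeasurePreserving_eval (fun _ => μ) a)
  rw [memLp_two_iff_integrable_sq_norm hmeas]
  have := Integrable.fintype_prod (μ := fun _ : ι => μ) (f := fun a x => ‖f a x‖ ^ 2)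
    fun a => (memLp_two_iff_integrable_sq_norm (hf a).1).1 (hf a)
  simpa [norm_prod, Finset.prod_pow] using this

/-- The product `f_0(w_0) ⋯ f_{N-1}(w_{N-1})` of square-integrable functions of separate
variables. -/
def lpProd (f : ι → Lp 𝕜 2 μ) : Lp 𝕜 2 (Measure.pi fun _ : ι => μ) :=
  (memLp_two_pi_prod fun a => Lp.memLp (f a)).toLp _

theorem inner_lpProd (f g : ι → Lp 𝕜 2 μ) :
    inner 𝕜 (lpProd f) (lpProd g) = ∏ a, inner 𝕜 (f a) (g a) := by
  simp_rw [L2.inner_def]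
  rw [← integral_fintype_prod_eq_prod]
  refine integral_congr_ae ?_
  filter_upwards [MemLp.coeFn_toLp (memLp_two_pi_prod fun a => Lp.memLp (f a)),
    MemLp.coeFn_toLp (memLp_two_pi_prod fun a => Lp.memLp (g a))] with w hf hg
  rw [lpProd, lpProd, hf, hg]
  simp [Finset.prod_mul_distrib]

variable [DecidableEq ι]

/-- The wedge product of square-integrable functions, as the antisymmetrized product of functions of
separate variables. -/
def lpWedge (f : ι → Lp 𝕜 2 μ) : Lp 𝕜 2 (Measure.pi fun _ : ι => μ) :=
  (((Real.sqrt (Fintype.card ι).factorial)⁻¹ : ℝ) : 𝕜) •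
    ∑ σ : Equiv.Perm ι, ((Equiv.Perm.sign σ : ℤ) : 𝕜) • lpProd (f ∘ σ)

theorem sum_inner_sign_smul_lpProd (f g : ι → Lp 𝕜 2 μ) (τ : Equiv.Perm ι) :
    ∑ σ : Equiv.Perm ι, inner 𝕜 (((Equiv.Perm.sign σ : ℤ) : 𝕜) • lpProd (f ∘ σ))
      (((Equiv.Perm.sign τ : ℤ) : 𝕜) • lpProd (g ∘ τ)) = (crossGram 𝕜 f g).det := by
  have hτ : (crossGram 𝕜 f g).det =
      ((Equiv.Perm.sign τ : ℤ) : 𝕜) * ((crossGram 𝕜 f g).submatrix id τ).det := by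
    rw [Matrix.det_permute', ← mul_assoc, ← Int.cast_mul, Int.units_coe_mul_self, Int.cast_one,
      one_mul]
  rw [hτ, Matrix.det_apply', Finset.mul_sum]
  refine Finset.sum_congr rfl fun σ _ => ?_
  rw [inner_smul_left, inner_smul_right, inner_lpProd, map_intCast, mul_left_comm]
  rfl

theorem isWedge_lpWedge : IsWedge 𝕜 (lpWedge : (ι → Lp 𝕜 2 μ) → _) := by
  intro f g
  have hfac : ((Fintype.card ι).factorial : 𝕜) ≠ 0 :=
    Nat.cast_ne_zero.2 (Fintype.card ι).factorial_ne_zero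
  rw [lpWedge, lpWedge, inner_smul_left, inner_smul_right, inner_sum]
  simp_rw [sum_inner, sum_inner_sign_smul_lpProd]
  rw [Finset.sum_const, Finset.card_univ, Fintype.card_perm, nsmul_eq_mul, RCLike.conj_ofReal,
    ← mul_assoc, ← RCLike.ofReal_mul, ← mul_inv, Real.mul_self_sqrt (by positivity), ← mul_assoc,
    RCLike.ofReal_inv, RCLike.ofReal_natCast, inv_mul_cancel₀ hfac, one_mul]

end LpWedge

/-! ### The Fubini–Study form -/

section FubiniStudy

variable {n : ℕ} {E : Type*} [NormedAddCommGroup E] [InnerProductSpace ℂ E]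

/-- The Fubini–Study Hermitian form at the point `[x]` of projective space, on tangent vectors
represented by vectors of `E`. Like `inner`, it is conjugate linear in the first vector. -/
def fsForm (x v w : E) : ℂ :=
  inner ℂ ((ℂ ∙ x)ᗮ.starProjection v) ((ℂ ∙ x)ᗮ.starProjection w) / inner ℂ x x

/-- The Fubini–Study length of the tangent vector at `[x]` represented by `v`. -/
def fsNorm (x v : E) : ℝ :=
  ‖(ℂ ∙ x)ᗮ.starProjection v‖ / ‖x‖

theorem starProjection_orthogonal_singleton (x v : E) :
    (ℂ ∙ x)ᗮ.starProjection v = v - (inner ℂ x v / inner ℂ x x) • x := by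
  rw [Submodule.starProjection_orthogonal_val, Submodule.starProjection_singleton,
    inner_self_eq_norm_sq_to_K]
  norm_cast

theorem fsForm_eq {x : E} (hx : x ≠ 0) (v w : E) :
    fsForm x v w =
      (inner ℂ v w * inner ℂ x x - inner ℂ v x * inner ℂ x w) / inner ℂ x x ^ 2 := by
  have hxx : inner ℂ x x ≠ 0 := inner_self_eq_zero.not.2 hx
  have horth : inner ℂ (v - (inner ℂ x v / inner ℂ x x) • x) x = 0 := by
    rw [inner_sub_left, inner_smul_left, map_div₀, inner_conj_symm, inner_conj_symm,
      div_mul_cancel₀ _ hxx, sub_self]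
  rw [fsForm, starProjection_orthogonal_singleton, starProjection_orthogonal_singleton,
    inner_sub_right, inner_smul_right, horth, mul_zero, sub_zero, inner_sub_left, inner_smul_left,
    map_div₀, inner_conj_symm, inner_conj_symm]
  field_simp

theorem fsForm_self (x v : E) : fsForm x v v = (fsNorm x v ^ 2 : ℝ) := by
  rw [fsForm, fsNorm, inner_self_eq_norm_sq_to_K, inner_self_eq_norm_sq_to_K, div_pow]
  norm_cast

theorem fsForm_linearCombination {ι : Type*} [Fintype ι] (x : E) (c : ι → ℂ) (v : ι → E) :
    fsForm x (∑ i, starRingEnd ℂ (c i) • v i) (∑ j, starRingEnd ℂ (c j) • v j) =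
      ∑ i, ∑ j, fsForm x (v i) (v j) * c i * starRingEnd ℂ (c j) := by
  simp only [fsForm, map_sum, map_smul, sum_inner, inner_sum, inner_smul_left, inner_smul_right,
    Complex.conj_conj, Finset.mul_sum, Finset.sum_div]
  rw [Finset.sum_comm]
  exact Finset.sum_congr rfl fun i _ => Finset.sum_congr rfl fun j _ => by ring

theorem fsNorm_le (x v : E) : fsNorm x v ≤ ‖v‖ / ‖x‖ :=
  div_le_div_of_nonneg_right (Submodule.norm_starProjection_apply_le _ v) (norm_nonneg x)

theorem fsNorm_nonneg (x v : E) : 0 ≤ fsNorm x v := by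
  unfold fsNorm; positivity

/-- The Fubini–Study matrix is, up to a scalar, the Schur complement of the first entry of the Gram
matrix. -/
theorem det_crossGram_cons {x : E} (hx : x ≠ 0) (v : Fin n → E) :
    (crossGram ℂ (Fin.cons x v : Fin (n + 1) → E) (Fin.cons x v)).det =
      inner ℂ x x ^ (n + 1) * (Matrix.of fun i j => fsForm x (v i) (v j)).det := by
  have hxx : inner ℂ x x ≠ 0 := inner_self_eq_zero.not.2 hx
  set y : Fin (n + 1) → E := Fin.cons x v with hy
  set c : Fin (n + 1) → ℂ := Fin.cons 0 fun i => inner ℂ (v i) x / inner ℂ x x with hc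
  set B : Matrix (Fin (n + 1)) (Fin (n + 1)) ℂ :=
    Matrix.of fun a b => inner ℂ (y a) (y b) - c a * inner ℂ x (y b) with hB
  have hdet : (crossGram ℂ y y).det = B.det :=
    Matrix.det_eq_of_forall_row_eq_smul_add_const c 0 rfl fun a b => by
      simp [crossGram, hB, hc, hy]
  have hcol : ∀ i : Fin n, B i.succ 0 = 0 := fun i => by
    simp only [hB, hc, hy, Matrix.of_apply, Fin.cons_succ, Fin.cons_zero]
    rw [div_mul_cancel₀ _ hxx, sub_self]
  have hminor : B.submatrix Fin.succ Fin.succ =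
      inner ℂ x x • Matrix.of fun i j => fsForm x (v i) (v j) := by
    ext i j
    simp only [hB, hc, hy, Matrix.submatrix_apply, Matrix.of_apply, Fin.cons_succ,
      Matrix.smul_apply, smul_eq_mul, fsForm_eq hx]
    field_simp
  have hcorner : B 0 0 = inner ℂ x x := by simp [hB, hc, hy]
  rw [hdet, Matrix.det_succ_column_zero, Fin.sum_univ_succ,
    Finset.sum_eq_zero fun i _ => by rw [hcol]; simp, Fin.succAbove_zero, hminor, hcorner,
    Matrix.det_smul, Fintype.card_fin]
  simp only [Fin.val_zero, pow_zero, one_mul, add_zero]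
  ring

/-- The derivative of the projection onto the moving line `ℂ x(t)` only sees the component of
`x'(t)` orthogonal to `x(t)`. -/
theorem hasDerivWithinAt_starProjection_singleton {x : ℝ → E} {x' : E} {s : Set ℝ} {t : ℝ}
    (hx : HasDerivWithinAt x x' s t) (h0 : x t ≠ 0) (v : E) :
    HasDerivWithinAt (fun t => (ℂ ∙ x t).starProjection v)
      ((inner ℂ (x t) v / inner ℂ (x t) (x t)) • (ℂ ∙ x t)ᗮ.starProjection x' +
        (inner ℂ ((ℂ ∙ x t)ᗮ.starProjection x') v / inner ℂ (x t) (x t)) • x t) s t := by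
  have hN : inner ℂ (x t) (x t) ≠ 0 := inner_self_eq_zero.not.2 h0
  have hproj : (fun t => (ℂ ∙ x t).starProjection v) =
      fun t => (inner ℂ (x t) v / inner ℂ (x t) (x t)) • x t := by
    ext1 t
    rw [Submodule.starProjection_singleton, inner_self_eq_norm_sq_to_K]
    norm_cast
  rw [hproj]
  refine (((hx.inner ℂ (hasDerivWithinAt_const t s v)).div (hx.inner ℂ hx) hN).smul
    hx).congr_deriv ?_
  rw [starProjection_orthogonal_singleton, inner_sub_left, inner_smul_left, map_div₀,
    inner_conj_symm, inner_conj_symm, inner_zero_right, smul_sub, smul_smul, sub_add_eq_add_sub,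
    add_sub_assoc, ← sub_smul]
  congr 2
  field_simp
  ring

theorem norm_deriv_starProjection_singleton_le {x : E} (y v : E) :
    ‖(inner ℂ x v / inner ℂ x x) • (ℂ ∙ x)ᗮ.starProjection y +
        (inner ℂ ((ℂ ∙ x)ᗮ.starProjection y) v / inner ℂ x x) • x‖ ≤ 2 * fsNorm x y * ‖v‖ := by
  rcases eq_or_ne x 0 with rfl | hx
  · simp [fsNorm]
  have hxx : ‖inner ℂ x x‖ = ‖x‖ ^ 2 := by rw [inner_self_eq_norm_sq_to_K]; simp
  set q := (ℂ ∙ x)ᗮ.starProjection y with hq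
  calc ‖(inner ℂ x v / inner ℂ x x) • q + (inner ℂ q v / inner ℂ x x) • x‖
      ≤ ‖inner ℂ x v‖ / ‖x‖ ^ 2 * ‖q‖ + ‖inner ℂ q v‖ / ‖x‖ ^ 2 * ‖x‖ := by
        refine (norm_add_le _ _).trans_eq ?_
        rw [norm_smul, norm_smul, norm_div, norm_div, hxx]
    _ ≤ ‖x‖ * ‖v‖ / ‖x‖ ^ 2 * ‖q‖ + ‖q‖ * ‖v‖ / ‖x‖ ^ 2 * ‖x‖ := by
        gcongr <;> exact norm_inner_le_norm _ _
    _ = 2 * fsNorm x y * ‖v‖ := by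
        rw [fsNorm, ← hq]
        field_simp
        ring

end FubiniStudy

/-! ### Wirtinger calculus of antiholomorphic maps -/

section Wirtinger

variable {n : ℕ} {z : Fin n → ℂ}

theorem single_I (i : Fin n) :
    (Pi.single i Complex.I : Fin n → ℂ) = Complex.I • Pi.single i 1 := by
  rw [← Pi.single_smul, smul_eq_mul, mul_one]

theorem dzbar_comp {f : (Fin n → ℂ) → ℂ} {g : ℂ → ℂ} {g' : ℂ} (hg : HasDerivAt g g' (f z))
    (hf : DifferentiableAt ℝ f z) (i : Fin n) :
    dzbar i (fun w => g (f w)) z = g' * dzbar i f z := by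
  have h : fderiv ℝ (fun w => g (f w)) z = g' • fderiv ℝ f z :=
    (hg.comp_hasFDerivAt z hf.hasFDerivAt).fderiv
  simp only [dzbar, h, smul_apply, smul_eq_mul]
  ring

theorem dz_div {f g : (Fin n → ℂ) → ℂ} (hf : DifferentiableAt ℝ f z)
    (hg : DifferentiableAt ℝ g z) (h0 : g z ≠ 0) (i : Fin n) :
    dz i (fun w => f w / g w) z = (dz i f z * g z - f z * dz i g z) / g z ^ 2 := by
  have h : HasFDerivAt (fun w => f w / g w)
      (f z • (-(g z ^ 2)⁻¹) • fderiv ℝ g z + (g z)⁻¹ • fderiv ℝ f z) z := by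
    simp only [div_eq_mul_inv]
    exact hf.hasFDerivAt.mul ((hasDerivAt_inv h0).comp_hasFDerivAt z hg.hasFDerivAt)
  simp only [dz, h.fderiv, add_apply, smul_apply, smul_eq_mul]
  field_simp
  ring

variable {V E : Type*} [NormedAddCommGroup V] [NormedSpace ℂ V] [NormedAddCommGroup E]

/-- A map is antiholomorphic at `z` if it is real differentiable there with a conjugate linear
derivative. -/
structure IsAntiholomorphicAt [NormedSpace ℂ E] (F : V → E) (z : V) : Prop where
  differentiableAt : DifferentiableAt ℝ F z
  fderiv_I_smul : ∀ X, fderiv ℝ F z (Complex.I • X) = -(Complex.I • fderiv ℝ F z X)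

namespace IsAntiholomorphicAt

section NormedSpace

variable [NormedSpace ℂ E]

theorem fderiv_smul {F : V → E} {z : V} (hF : IsAntiholomorphicAt F z) (c : ℂ) (X : V) :
    fderiv ℝ F z (c • X) = starRingEnd ℂ c • fderiv ℝ F z X := by
  have hc : c • X = c.re • X + c.im • (Complex.I • X) := by
    conv_lhs => rw [← Complex.re_add_im c, add_smul, mul_smul, Complex.coe_smul, Complex.coe_smul]
  have hconj : starRingEnd ℂ c = c.re - c.im * Complex.I := by
    apply Complex.ext <;> simp
  rw [hc, map_add, map_smul, map_smul, hF.fderiv_I_smul, hconj, sub_smul, mul_smul,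
    Complex.coe_smul, Complex.coe_smul, smul_neg, sub_eq_add_neg]

theorem fderiv_eq_sum {F : (Fin n → ℂ) → E} (hF : IsAntiholomorphicAt F z) (X : Fin n → ℂ) :
    fderiv ℝ F z X = ∑ i, starRingEnd ℂ (X i) • fderiv ℝ F z (Pi.single i 1) := by
  conv_lhs => rw [pi_eq_sum_univ' X]
  simp only [map_sum, ← hF.fderiv_smul]

theorem fderiv_apply {F : V → E} {z : V} (hF : ContDiffAt ℝ 2 F z)
    (hanti : ∀ᶠ w in 𝓝 z, IsAntiholomorphicAt F w) (v : V) :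
    IsAntiholomorphicAt (fun w => fderiv ℝ F w v) z := by
  have hd : DifferentiableAt ℝ (fderiv ℝ F) z :=
    (hF.fderiv_right (m := 1) (by norm_num)).differentiableAt (by norm_num)
  have hsymm : ∀ u X, fderiv ℝ (fun w => fderiv ℝ F w u) z X =
      fderiv ℝ (fun w => fderiv ℝ F w X) z u := fun u X => by
    rw [fderiv_clm_apply hd (differentiableAt_const u), fderiv_clm_apply hd
      (differentiableAt_const X)]
    simpa using hF.isSymmSndFDerivAt (by simp) X u
  refine ⟨hd.clm_apply (differentiableAt_const v), fun X => ?_⟩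
  have hI : (fun w => fderiv ℝ F w (Complex.I • X)) =ᶠ[𝓝 z]
      fun w => -(Complex.I • fderiv ℝ F w X) := hanti.mono fun w hw => hw.fderiv_I_smul X
  have hdX : DifferentiableAt ℝ (fun w => fderiv ℝ F w X) z :=
    hd.clm_apply (differentiableAt_const X)
  rw [hsymm v, hsymm v, hI.fderiv_eq, fderiv_fun_neg, fderiv_fun_const_smul hdX]
  rfl

end NormedSpace

variable [InnerProductSpace ℂ E] {F G : (Fin n → ℂ) → E}

theorem dz_inner (hF : IsAntiholomorphicAt F z) (hG : IsAntiholomorphicAt G z) (i : Fin n) :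
    dz i (fun w => inner ℂ (F w) (G w)) z = inner ℂ (fderiv ℝ F z (Pi.single i 1)) (G z) := by
  rw [dz, single_I, fderiv_inner_apply ℂ hF.differentiableAt hG.differentiableAt,
    fderiv_inner_apply ℂ hF.differentiableAt hG.differentiableAt, hF.fderiv_I_smul,
    hG.fderiv_I_smul]
  simp only [inner_neg_left, inner_neg_right, inner_smul_left, inner_smul_right, Complex.conj_I]
  linear_combination (inner ℂ (F z) (fderiv ℝ G z (Pi.single i 1)) -
    inner ℂ (fderiv ℝ F z (Pi.single i 1)) (G z)) / 2 * Complex.I_mul_I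

theorem dzbar_inner (hF : IsAntiholomorphicAt F z) (hG : IsAntiholomorphicAt G z) (i : Fin n) :
    dzbar i (fun w => inner ℂ (F w) (G w)) z = inner ℂ (F z) (fderiv ℝ G z (Pi.single i 1)) := by
  rw [dzbar, single_I, fderiv_inner_apply ℂ hF.differentiableAt hG.differentiableAt,
    fderiv_inner_apply ℂ hF.differentiableAt hG.differentiableAt, hF.fderiv_I_smul,
    hG.fderiv_I_smul]
  simp only [inner_neg_left, inner_neg_right, inner_smul_left, inner_smul_right, Complex.conj_I]
  linear_combination (inner ℂ (fderiv ℝ F z (Pi.single i 1)) (G z) -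
    inner ℂ (F z) (fderiv ℝ G z (Pi.single i 1))) / 2 * Complex.I_mul_I

end IsAntiholomorphicAt

variable [InnerProductSpace ℂ E] {F : (Fin n → ℂ) → E}

theorem dzbar_log_norm_sq (hF : IsAntiholomorphicAt F z) (h0 : F z ≠ 0) (j : Fin n) :
    dzbar j (fun w => ((Real.log (‖F w‖ ^ 2) : ℝ) : ℂ)) z =
      inner ℂ (F z) (fderiv ℝ F z (Pi.single j 1)) / inner ℂ (F z) (F z) := by
  have hinner : ∀ x : E, inner ℂ x x = ((‖x‖ ^ 2 : ℝ) : ℂ) := fun x => by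
    rw [inner_self_eq_norm_sq_to_K]; norm_cast
  have hlog : (fun w => ((Real.log (‖F w‖ ^ 2) : ℝ) : ℂ)) =
      fun w => Complex.log (inner ℂ (F w) (F w)) := by
    ext1 w
    rw [hinner, Complex.ofReal_log (by positivity)]
  have hmem : inner ℂ (F z) (F z) ∈ Complex.slitPlane := by
    rw [hinner, Complex.ofReal_mem_slitPlane]
    have := norm_pos_iff.2 h0
    positivity
  rw [hlog, dzbar_comp (Complex.hasDerivAt_log hmem)
    (hF.differentiableAt.inner ℂ hF.differentiableAt), hF.dzbar_inner hF, inv_mul_eq_div]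

theorem complexHessian_log_norm_sq (hF : ContDiffAt ℝ 2 F z)
    (hanti : ∀ᶠ w in 𝓝 z, IsAntiholomorphicAt F w) (h0 : F z ≠ 0) (i j : Fin n) :
    complexHessian (fun w => Real.log (‖F w‖ ^ 2)) z i j =
      fsForm (F z) (fderiv ℝ F z (Pi.single i 1)) (fderiv ℝ F z (Pi.single j 1)) := by
  have hFz := hanti.self_of_nhds
  have hGz := IsAntiholomorphicAt.fderiv_apply hF hanti (Pi.single j 1)
  have hev : (dzbar j fun w => ((Real.log (‖F w‖ ^ 2) : ℝ) : ℂ)) =ᶠ[𝓝 z] fun w =>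
      inner ℂ (F w) (fderiv ℝ F w (Pi.single j 1)) / inner ℂ (F w) (F w) := by
    filter_upwards [hanti, hFz.differentiableAt.continuousAt.eventually_ne h0] with w h1 h2
    exact dzbar_log_norm_sq h1 h2 j
  rw [complexHessian, Matrix.of_apply, dz, hev.fderiv_eq, ← dz,
    dz_div (hFz.differentiableAt.inner ℂ hGz.differentiableAt)
      (hFz.differentiableAt.inner ℂ hFz.differentiableAt) (inner_self_eq_zero.not.2 h0),
    hFz.dz_inner hGz, hFz.dz_inner hFz, fsForm_eq h0]
  ring

theorem sum_complexHessian_log_norm_sq (hF : ContDiffAt ℝ 2 F z)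
    (hanti : ∀ᶠ w in 𝓝 z, IsAntiholomorphicAt F w) (h0 : F z ≠ 0) (X : Fin n → ℂ) :
    ∑ i, ∑ j, complexHessian (fun w => Real.log (‖F w‖ ^ 2)) z i j * X i * starRingEnd ℂ (X j) =
      (fsNorm (F z) (fderiv ℝ F z X) ^ 2 : ℝ) := by
  simp only [complexHessian_log_norm_sq hF hanti h0]
  rw [← fsForm_linearCombination, ← hanti.self_of_nhds.fderiv_eq_sum, fsForm_self]

theorem contDiffAt_log_norm_sq (hF : ContDiffAt ℝ 2 F z) (h0 : F z ≠ 0) :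
    ContDiffAt ℝ 2 (fun w => ((Real.log (‖F w‖ ^ 2) : ℝ) : ℂ)) z :=
  Complex.ofRealCLM.contDiff.contDiffAt.comp z
    ((hF.norm_sq ℂ).log (pow_ne_zero _ (norm_ne_zero_iff.2 h0)))

theorem complexHessian_congr {u v : (Fin n → ℂ) → ℝ} (h : u =ᶠ[𝓝 z] v) :
    complexHessian u z = complexHessian v z := by
  ext i j
  have hbar : (dzbar j fun w => (u w : ℂ)) =ᶠ[𝓝 z] dzbar j fun w => (v w : ℂ) := by
    filter_upwards [h.eventuallyEq_nhds] with w hw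
    have hcoe : (fun w => (u w : ℂ)) =ᶠ[𝓝 w] fun w => (v w : ℂ) := hw.fun_comp Complex.ofReal
    simp only [dzbar, hcoe.fderiv_eq]
  simp only [complexHessian, Matrix.of_apply, dz, hbar.fderiv_eq]

theorem differentiableAt_dzbar {f : (Fin n → ℂ) → ℂ} (hf : ContDiffAt ℝ 2 f z) (j : Fin n) :
    DifferentiableAt ℝ (dzbar j f) z := by
  have hd : DifferentiableAt ℝ (fderiv ℝ f) z :=
    (hf.fderiv_right (m := 1) (by norm_num)).differentiableAt (by norm_num)
  have happ : ∀ v : Fin n → ℂ, DifferentiableAt ℝ (fun w => fderiv ℝ f w v) z := fun v =>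
    hd.clm_apply (differentiableAt_const v)
  exact ((happ _).add ((differentiableAt_const _).mul (happ _))).mul (differentiableAt_const _)

theorem complexHessian_sub_mul {u v : (Fin n → ℂ) → ℝ}
    (hu : ContDiffAt ℝ 2 (fun w => (u w : ℂ)) z) (hv : ContDiffAt ℝ 2 (fun w => (v w : ℂ)) z)
    (c : ℝ) :
    complexHessian (fun w => u w - c * v w) z =
      complexHessian u z - (c : ℂ) • complexHessian v z := by
  ext i j
  have hbar : (dzbar j fun w => ((u w - c * v w : ℝ) : ℂ)) =ᶠ[𝓝 z] fun w =>
      dzbar j (fun w => (u w : ℂ)) w - c * dzbar j (fun w => (v w : ℂ)) w := by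
    filter_upwards [hu.eventually (by simp), hv.eventually (by simp)] with w hw1 hw2
    have hd1 := hw1.differentiableAt (by norm_num)
    have hd2 := hw2.differentiableAt (by norm_num)
    have hfd : fderiv ℝ (fun w => ((u w - c * v w : ℝ) : ℂ)) w =
        fderiv ℝ (fun w => (u w : ℂ)) w - (c : ℂ) • fderiv ℝ (fun w => (v w : ℂ)) w := by
      push_cast
      rw [fderiv_fun_sub hd1 (hd2.const_mul _), fderiv_const_mul hd2]
    simp only [dzbar, hfd, sub_apply, smul_apply, smul_eq_mul]
    ring
  have hd1 := differentiableAt_dzbar hu j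
  have hd2 := differentiableAt_dzbar hv j
  simp only [complexHessian, Matrix.of_apply, Matrix.sub_apply, Matrix.smul_apply, dz,
    hbar.fderiv_eq]
  rw [fderiv_fun_sub hd1 (hd2.const_mul _), fderiv_const_mul hd2]
  simp only [sub_apply, smul_apply, smul_eq_mul]
  ring

end Wirtinger

/-! ### Mean values over circles and holomorphy -/

section CircularMollifier

open scoped ContDiff

variable {n : ℕ}

/-- A smooth density on `ℂⁿ`, supported in the closed ball of radius `r` about `0` and invariant
under the action of the unit circle, against which mean values over circles are tested. -/
structure IsCircularMollifier (r : ℝ) (ρ : (Fin n → ℂ) → ℝ) : Prop where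
  contDiff : ContDiff ℝ ∞ ρ
  eq_zero : ∀ ⦃w⦄, r < ‖w‖ → ρ w = 0
  unit_smul : ∀ ⦃c : ℂ⦄, ‖c‖ = 1 → ∀ w, ρ (c • w) = ρ w
  integral_eq_one : ∫ w, ρ w = 1

theorem contDiff_smoothTransition_sub_sum_normSq (a : ℝ) :
    ContDiff ℝ ∞ fun w : Fin n → ℂ =>
      Real.smoothTransition (a - ∑ i, Complex.normSq (w i)) := by
  refine Real.smoothTransition.contDiff.comp (contDiff_const.sub (ContDiff.sum fun i _ => ?_))
  have hi : ContDiff ℝ ∞ fun w : Fin n → ℂ => w i := contDiff_apply ℝ ℂ i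
  simp only [Complex.normSq_apply]
  exact ((Complex.reCLM.contDiff.comp hi).mul (Complex.reCLM.contDiff.comp hi)).add
    ((Complex.imCLM.contDiff.comp hi).mul (Complex.imCLM.contDiff.comp hi))

theorem sq_le_sum_normSq {r : ℝ} (hr : 0 ≤ r) {w : Fin n → ℂ} (hw : r < ‖w‖) :
    r ^ 2 ≤ ∑ i, Complex.normSq (w i) := by
  obtain ⟨i, hi⟩ : ∃ i, r < ‖w i‖ := by
    by_contra! h
    exact hw.not_ge ((pi_norm_le_iff_of_nonneg hr).2 h)
  calc r ^ 2 ≤ ‖w i‖ ^ 2 := by gcongr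
    _ = Complex.normSq (w i) := (Complex.normSq_eq_norm_sq _).symm
    _ ≤ ∑ i, Complex.normSq (w i) :=
      Finset.single_le_sum (f := fun i => Complex.normSq (w i))
        (fun j _ => Complex.normSq_nonneg _) (Finset.mem_univ i)

theorem exists_isCircularMollifier {r : ℝ} (hr : 0 < r) :
    ∃ ρ : (Fin n → ℂ) → ℝ, IsCircularMollifier r ρ := by
  set φ : (Fin n → ℂ) → ℝ := fun w => Real.smoothTransition (r ^ 2 - ∑ i, Complex.normSq (w i))
  have hφ : ContDiff ℝ ∞ φ := contDiff_smoothTransition_sub_sum_normSq (r ^ 2)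
  have hzero : ∀ ⦃w⦄, r < ‖w‖ → φ w = 0 := fun w hw =>
    Real.smoothTransition.zero_of_nonpos (sub_nonpos.2 (sq_le_sum_normSq hr.le hw))
  have hsupp : HasCompactSupport φ :=
    HasCompactSupport.intro (isCompact_closedBall 0 r) fun w hw => hzero (by simpa using hw)
  have hpos : 0 < ∫ w, φ w := by
    refine hφ.continuous.integral_pos_of_hasCompactSupport_nonneg_nonzero hsupp
      (fun w => Real.smoothTransition.nonneg _) (x := 0) (Real.smoothTransition.pos_of_pos ?_).ne'
    simpa using pow_pos hr 2
  refine ⟨fun w => (∫ v, φ v)⁻¹ * φ w, contDiff_const.mul hφ, fun w hw => ?_, fun c hc w => ?_, ?_⟩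
  · rw [hzero hw, mul_zero]
  · simp [φ, Complex.normSq_eq_norm_sq, hc]
  · rw [integral_const_mul, inv_mul_cancel₀ hpos.ne']

theorem measurePreserving_unit_smul {c : ℂ} (hc : ‖c‖ = 1) :
    MeasurePreserving (fun w : Fin n → ℂ => c • w) volume volume := by
  have h : MeasurePreserving (fun x : ℂ => c * x) volume volume :=
    (rotation ⟨c, by simpa [Submonoid.unitSphere] using hc⟩).measurePreserving
  exact volume_preserving_pi (fun _ : Fin n => h)

theorem integral_unit_smul {X : Type*} [NormedAddCommGroup X] [NormedSpace ℝ X] {c : ℂ}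
    (hc : ‖c‖ = 1) (g : (Fin n → ℂ) → X) : ∫ w, g (c • w) = ∫ w, g w := by
  have hc0 : c ≠ 0 := norm_ne_zero_iff.1 (hc ▸ one_ne_zero)
  exact (measurePreserving_unit_smul hc).integral_comp
    (Homeomorph.smulOfNeZero c hc0).measurableEmbedding g

namespace IsCircularMollifier

variable {r : ℝ} {ρ : (Fin n → ℂ) → ℝ}

theorem hasCompactSupport (hρ : IsCircularMollifier r ρ) : HasCompactSupport ρ :=
  HasCompactSupport.intro (isCompact_closedBall 0 r) fun w hw => hρ.eq_zero (by simpa using hw)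

theorem setIntegral_closedBall_smul {X : Type*} [NormedAddCommGroup X] [NormedSpace ℝ X]
    (hρ : IsCircularMollifier r ρ) (g : (Fin n → ℂ) → X) :
    ∫ w in Metric.closedBall 0 r, ρ w • g w = ∫ w, ρ w • g w :=
  setIntegral_eq_integral_of_forall_compl_eq_zero fun w hw => by
    rw [hρ.eq_zero (by simpa using hw), zero_smul]

variable {X : Type*} [NormedAddCommGroup X] [NormedSpace ℝ X]

theorem integrable_circleMap_smul (hρ : IsCircularMollifier r ρ) {F : (Fin n → ℂ) → X}
    {z : Fin n → ℂ} (hF : ContinuousOn F (Metric.closedBall z r)) :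
    Integrable (Function.uncurry fun (θ : ℝ) w => ρ w • F (z + circleMap 0 1 θ • w))
      ((volume.restrict (uIoc 0 (2 * Real.pi))).prod
        (volume.restrict (Metric.closedBall 0 r))) := by
  rw [Measure.prod_restrict]
  refine IntegrableOn.mono_set (t := uIcc 0 (2 * Real.pi) ×ˢ Metric.closedBall 0 r) ?_
    (prod_mono uIoc_subset_uIcc subset_rfl)
  refine ContinuousOn.integrableOn_compact (isCompact_uIcc.prod (isCompact_closedBall 0 r)) ?_
  refine (hρ.contDiff.continuous.comp continuous_snd).continuousOn.smul
    (hF.comp (Continuous.continuousOn ?_) fun p hp => ?_)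
  · exact continuous_const.add (((continuous_circleMap 0 1).comp continuous_fst).smul
      continuous_snd)
  · simpa [norm_smul] using hp.2

theorem integral_smul_eq_of_circleAverage_eq [CompleteSpace X] (hρ : IsCircularMollifier r ρ)
    {F : (Fin n → ℂ) → X} {z : Fin n → ℂ} (hF : ContinuousOn F (Metric.closedBall z r))
    (hmean : ∀ w, ‖w‖ ≤ r → Real.circleAverage (fun c => F (z + c • w)) 0 1 = F z) :
    ∫ w, ρ w • F (z + w) = F z := by
  have hrot : ∀ θ : ℝ, ∫ w in Metric.closedBall 0 r, ρ w • F (z + circleMap 0 1 θ • w) =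
      ∫ w, ρ w • F (z + w) := fun θ => by
    have hθ : ‖circleMap 0 1 θ‖ = 1 := by simp
    rw [hρ.setIntegral_closedBall_smul, ← integral_unit_smul hθ fun w => ρ w • F (z + w)]
    simp only [hρ.unit_smul hθ]
  calc ∫ w, ρ w • F (z + w)
      = Real.circleAverage (fun _ => ∫ w, ρ w • F (z + w)) 0 1 :=
        (Real.circleAverage_const _ _ _).symm
    _ = (2 * Real.pi)⁻¹ • ∫ θ in 0..2 * Real.pi,
          ∫ w in Metric.closedBall 0 r, ρ w • F (z + circleMap 0 1 θ • w) := by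
        simp only [hrot, Real.circleAverage_def]
    _ = (2 * Real.pi)⁻¹ • ∫ w in Metric.closedBall 0 r,
          ∫ θ in 0..2 * Real.pi, ρ w • F (z + circleMap 0 1 θ • w) := by
        rw [intervalIntegral_integral_swap (hρ.integrable_circleMap_smul hF)]
    _ = ∫ w in Metric.closedBall 0 r,
          ρ w • Real.circleAverage (fun c => F (z + c • w)) 0 1 := by
        rw [← integral_smul]
        simp only [Real.circleAverage_def, intervalIntegral.integral_smul, smul_comm (ρ _)]
    _ = ∫ w in Metric.closedBall 0 r, ρ w • F z :=
        setIntegral_congr_fun Metric.isClosed_closedBall.measurableSet fun w hw => by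
          simp only [hmean w (by simpa using hw)]
    _ = F z := by
        rw [hρ.setIntegral_closedBall_smul, integral_smul_const, hρ.integral_eq_one, one_smul]

end IsCircularMollifier

variable {X : Type*} [NormedAddCommGroup X] {U : Set (Fin n → ℂ)} {F : (Fin n → ℂ) → X}

theorem exists_eventually_closedBall_subset {α : Type*} [PseudoMetricSpace α] {s : Set α} {x : α}
    (hs : s ∈ 𝓝 x) : ∃ r > 0, ∀ᶠ y in 𝓝 x, Metric.closedBall y r ⊆ s := by
  obtain ⟨r, hr, hball⟩ := Metric.mem_nhds_iff.1 hs
  refine ⟨r / 2, by positivity, ?_⟩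
  filter_upwards [Metric.ball_mem_nhds x (by positivity : 0 < r / 2)] with y hy
  refine (Metric.closedBall_subset_ball' ?_).trans hball
  linarith [Metric.mem_ball.1 hy]

/-- Near `z`, the function `F` is its own convolution with a circular mollifier. -/
theorem contDiffAt_of_circleAverage_eq [NormedSpace ℝ X] [CompleteSpace X] {z : Fin n → ℂ}
    (hU : U ∈ 𝓝 z) (hF : ContinuousOn F U)
    (hmean : ∀ y w, (∀ c : ℂ, ‖c‖ ≤ 1 → y + c • w ∈ U) →
      Real.circleAverage (fun c => F (y + c • w)) 0 1 = F y) :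
    ContDiffAt ℝ ∞ F z := by
  obtain ⟨R, hR, hRU⟩ := Metric.nhds_basis_closedBall.mem_iff.1 hU
  obtain ⟨r, hr, hev⟩ :=
    exists_eventually_closedBall_subset (Metric.closedBall_mem_nhds z hR)
  obtain ⟨ρ, hρ⟩ := exists_isCircularMollifier (n := n) hr
  set G := (Metric.closedBall z R).indicator F
  have hG : LocallyIntegrable G volume :=
    (((hF.mono hRU).integrableOn_compact (isCompact_closedBall z R)).integrable_indicator
      Metric.isClosed_closedBall.measurableSet).locallyIntegrable
  refine (hρ.hasCompactSupport.contDiff_convolution_left (ContinuousLinearMap.lsmul ℝ ℝ)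
    (n := ⊤) hρ.contDiff hG).contDiffAt.congr_of_eventuallyEq ?_
  filter_upwards [hev] with y hy
  have hmean' : ∀ w, ‖w‖ ≤ r → Real.circleAverage (fun c => F (y + c • w)) 0 1 = F y :=
    fun w hw => hmean y w fun c hc => hRU (hy (by
      simpa [norm_smul] using (mul_le_of_le_one_left (norm_nonneg w) hc).trans hw))
  have heven : ∀ w, ρ (-w) = ρ w := fun w => by
    simpa using hρ.unit_smul (c := -1) (by simp) w
  calc F y = ∫ w, ρ w • F (y + w) :=
        (hρ.integral_smul_eq_of_circleAverage_eq (hF.mono (hy.trans hRU)) hmean').symm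
    _ = ∫ w, ρ w • G (y + w) := by
        rw [← hρ.setIntegral_closedBall_smul, ← hρ.setIntegral_closedBall_smul fun w => G (y + w)]
        refine setIntegral_congr_fun Metric.isClosed_closedBall.measurableSet fun w hw => ?_
        simp only [G, indicator_of_mem (hy (show y + w ∈ _ by simpa using hw))]
    _ = ∫ w, ρ w • G (y - w) := by
        rw [← integral_neg_eq_self]
        simp only [heven, sub_eq_add_neg]

theorem circleAverage_eq_of_differentiableOn_lines [NormedSpace ℂ X] [CompleteSpace X]
    (hF : ∀ y v, DifferentiableOn ℂ (fun c : ℂ => F (y + c • v)) {c | y + c • v ∈ U})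
    {y v : Fin n → ℂ} (hyv : ∀ c : ℂ, ‖c‖ ≤ 1 → y + c • v ∈ U) :
    Real.circleAverage (fun c => F (y + c • v)) 0 1 = F y := by
  have hd : DiffContOnCl ℂ (fun c : ℂ => F (y + c • v)) (Metric.ball 0 |1|) := by
    rw [abs_one]
    refine DifferentiableOn.diffContOnCl ((hF y v).mono fun c hc => hyv c ?_)
    simpa [closure_ball] using hc
  simpa using hd.circleAverage

/-- Osgood's lemma. -/
theorem differentiableOn_of_differentiableOn_lines [NormedSpace ℂ X] [CompleteSpace X]
    (hU : IsOpen U) (hcont : ContinuousOn F U)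
    (hF : ∀ y v, DifferentiableOn ℂ (fun c : ℂ => F (y + c • v)) {c | y + c • v ∈ U}) :
    DifferentiableOn ℂ F U := by
  intro z hz
  have hd : DifferentiableAt ℝ F z :=
    (contDiffAt_of_circleAverage_eq (hU.mem_nhds hz) hcont fun y v hyv =>
      circleAverage_eq_of_differentiableOn_lines hF hyv).differentiableAt (by simp)
  have hsmul : ∀ (c : ℂ) (v : Fin n → ℂ), fderiv ℝ F z (c • v) = c • fderiv ℝ F z v := by
    intro c v
    have hline : HasFDerivAt (fun c : ℂ => z + c • v)
        (((ContinuousLinearMap.id ℂ ℂ).smulRight v).restrictScalars ℝ) 0 :=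
      (((hasFDerivAt_id (𝕜 := ℂ) (0 : ℂ)).smul_const v).const_add z).restrictScalars ℝ
    have hopen : IsOpen {c : ℂ | z + c • v ∈ U} := hU.preimage (by fun_prop)
    have hz₀ : z + (0 : ℂ) • v = z := by rw [zero_smul, add_zero]
    obtain ⟨L, hL⟩ := (hF z v).differentiableAt (x := 0) (hopen.mem_nhds (by simpa using hz))
    have hcomp := HasFDerivAt.comp 0 (hz₀.symm ▸ hd.hasFDerivAt :
      HasFDerivAt F (fderiv ℝ F z) (z + (0 : ℂ) • v)) hline
    have heq := hcomp.unique (hL.restrictScalars ℝ)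
    have happly : ∀ a : ℂ, fderiv ℝ F z (a • v) = L a := fun a => by
      simpa using DFunLike.congr_fun heq a
    calc fderiv ℝ F z (c • v) = L (c • 1) := by rw [happly, smul_eq_mul, mul_one]
      _ = c • fderiv ℝ F z ((1 : ℂ) • v) := by rw [map_smul, happly]
      _ = c • fderiv ℝ F z v := by rw [one_smul]
  refine DifferentiableAt.differentiableWithinAt ((differentiableAt_iff_restrictScalars ℝ hd).2 ?_)
  exact ⟨{ fderiv ℝ F z with map_smul' := hsmul }, rfl⟩

theorem differentiableOn_of_tendstoLocallyUniformlyOn [NormedSpace ℂ X] [CompleteSpace X]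
    {ι : Type*} {l : Filter ι} [l.NeBot] {f : ι → (Fin n → ℂ) → X} (hU : IsOpen U)
    (hlim : TendstoLocallyUniformlyOn f F l U) (hf : ∀ᶠ i in l, DifferentiableOn ℂ (f i) U) :
    DifferentiableOn ℂ F U := by
  refine differentiableOn_of_differentiableOn_lines hU
    (hlim.continuousOn (hf.mono fun i hi => hi.continuousOn).frequently) fun y v => ?_
  have hline : Differentiable ℂ fun c : ℂ => y + c • v := by fun_prop
  exact TendstoLocallyUniformlyOn.differentiableOn
    (hlim.comp _ (mapsTo_preimage _ _) hline.continuous.continuousOn)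
    (hf.mono fun i hi => hi.comp hline.differentiableOn (mapsTo_preimage _ _))
    (hU.preimage hline.continuous)

end CircularMollifier

section WeakHolomorphy

open scoped ContDiff

variable {H : Type*} [NormedAddCommGroup H] [InnerProductSpace ℂ H] [CompleteSpace H]

theorem exists_ball_norm_le_of_continuousOn_inner {E : Type*} [PseudoMetricSpace E] [ProperSpace E]
    {k : E → H} {U : Set E} (hU : IsOpen U) (hk : ∀ g, ContinuousOn (fun z => inner ℂ (k z) g) U)
    {z : E} (hz : z ∈ U) :
    ∃ r > 0, Metric.ball z r ⊆ U ∧ ∃ M, ∀ y ∈ Metric.ball z r, ‖k y‖ ≤ M := by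
  obtain ⟨r, hr, hrU⟩ := Metric.nhds_basis_closedBall.mem_iff.1 (hU.mem_nhds hz)
  have hpt : ∀ g, ∃ C, ∀ y : Metric.closedBall z r, ‖innerSL ℂ (k y) g‖ ≤ C := fun g => by
    obtain ⟨C, hC⟩ := (isCompact_closedBall z r).exists_bound_of_continuousOn ((hk g).mono hrU)
    exact ⟨C, fun y => hC y y.2⟩
  obtain ⟨M, hM⟩ := banach_steinhaus hpt
  refine ⟨r, hr, Metric.ball_subset_closedBall.trans hrU, M, fun y hy => ?_⟩
  simpa using hM ⟨y, Metric.ball_subset_closedBall hy⟩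

/-- By the Schwarz lemma, applied to the holomorphic functions `⟨k ·, g⟩`. -/
theorem continuousOn_of_differentiableOn_inner {E : Type*} [NormedAddCommGroup E] [NormedSpace ℂ E]
    [ProperSpace E] {k : E → H} {U : Set E} (hU : IsOpen U)
    (hk : ∀ g, DifferentiableOn ℂ (fun z => inner ℂ (k z) g) U) : ContinuousOn k U := by
  intro z hz
  obtain ⟨r, hr, hrU, M, hM⟩ :=
    exists_ball_norm_le_of_continuousOn_inner hU (fun g => (hk g).continuousOn) hz
  have hle : ∀ y ∈ Metric.ball z r, ‖k y - k z‖ ≤ 2 * M / r * dist y z := by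
    intro y hy
    have hmaps : ∀ g, MapsTo (fun w => inner ℂ (k w) g) (Metric.ball z r)
        (Metric.closedBall (inner ℂ (k z) g) (2 * M * ‖g‖)) := fun g w hw => by
      rw [Metric.mem_closedBall, dist_eq_norm, ← inner_sub_left]
      refine (norm_inner_le_norm _ _).trans ?_
      gcongr
      linarith [norm_sub_le (k w) (k z), hM w hw, hM z (Metric.mem_ball_self hr)]
    have hschwarz := Complex.dist_le_div_mul_dist_of_mapsTo_ball
      ((hk (k y - k z)).mono hrU) (hmaps _) hy
    rw [dist_eq_norm, ← inner_sub_left, inner_self_eq_norm_sq_to_K, norm_pow, RCLike.norm_ofReal,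
      abs_norm] at hschwarz
    rcases (norm_nonneg (k y - k z)).eq_or_lt' with h0 | hpos
    · rw [h0]
      have : 0 ≤ M := (norm_nonneg _).trans (hM y hy)
      positivity
    · refine le_of_mul_le_mul_right (le_trans (le_of_eq ?_) (hschwarz.trans_eq ?_)) hpos <;> ring
  refine ContinuousAt.continuousWithinAt (tendsto_iff_norm_sub_tendsto_zero.2 ?_)
  refine squeeze_zero_norm' (a := fun y => 2 * M / r * dist y z) ?_ ?_
  · filter_upwards [Metric.ball_mem_nhds z hr] with y hy
    simpa using hle y hy
  · have : Continuous fun y => 2 * M / r * dist y z := by fun_prop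
    simpa using this.tendsto z

theorem inner_circleAverage_left {F : ℂ → H} {c : ℂ} {R : ℝ} (hF : CircleIntegrable F c R) (g : H) :
    inner ℂ (Real.circleAverage F c R) g = Real.circleAverage (fun x => inner ℂ (F x) g) c R := by
  have h := (Complex.conjCLE.toContinuousLinearMap.comp
    ((innerSL ℂ g).restrictScalars ℝ)).circleAverage_comp_comm hF
  simpa [Function.comp_def] using h.symm

theorem contDiffAt_of_differentiableOn_inner {n : ℕ} {k : (Fin n → ℂ) → H} {U : Set (Fin n → ℂ)}
    (hU : IsOpen U) (hk : ∀ g, DifferentiableOn ℂ (fun z => inner ℂ (k z) g) U)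
    {z : Fin n → ℂ} (hz : z ∈ U) : ContDiffAt ℝ ∞ k z := by
  have hcont := continuousOn_of_differentiableOn_inner hU hk
  refine contDiffAt_of_circleAverage_eq (hU.mem_nhds hz) hcont fun y w hyw => ?_
  have hline : Differentiable ℂ fun c : ℂ => y + c • w := by fun_prop
  have hint : CircleIntegrable (fun c => k (y + c • w)) 0 1 :=
    (hcont.comp hline.continuous.continuousOn fun c hc => hyw c (by
      simpa using (mem_sphere_zero_iff_norm.1 hc).le)).circleIntegrable zero_le_one
  refine ext_inner_right ℂ fun g => ?_
  rw [inner_circleAverage_left hint]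
  exact circleAverage_eq_of_differentiableOn_lines (F := fun z => inner ℂ (k z) g) (U := U)
    (fun y v => (hk g).comp (by fun_prop) (mapsTo_preimage _ _)) hyw

end WeakHolomorphy

/-! ### The Bergman space -/

section BergmanSpace

open scoped ContDiff

variable {n : ℕ} {Ω : Set (Fin n → ℂ)}

variable (Ω) in
/-- The square-integrable holomorphic functions as a subspace of `L²(Ω)`. -/
def bergmanSpace : Submodule ℂ (Lp ℂ 2 (volume.restrict Ω)) where
  carrier := {g | ∃ f, DifferentiableOn ℂ f Ω ∧ g =ᵐ[volume.restrict Ω] f}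
  add_mem' := by
    rintro g g' ⟨f, hf, hg⟩ ⟨f', hf', hg'⟩
    exact ⟨f + f', hf.add hf', (Lp.coeFn_add g g').trans (hg.add hg')⟩
  zero_mem' := ⟨0, differentiableOn_const 0, Lp.coeFn_zero _ _ _⟩
  smul_mem' := by
    rintro c g ⟨f, hf, hg⟩
    exact ⟨c • f, hf.const_smul c, (Lp.coeFn_smul c g).trans (hg.const_smul c)⟩

theorem IsCircularMollifier.setIntegral_sub_smul_eq {X : Type*} [NormedAddCommGroup X]
    [NormedSpace ℂ X] [CompleteSpace X] {r : ℝ} {ρ : (Fin n → ℂ) → ℝ}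
    (hρ : IsCircularMollifier r ρ) {f : (Fin n → ℂ) → X} (hf : DifferentiableOn ℂ f Ω)
    {z : Fin n → ℂ} (hz : Metric.closedBall z r ⊆ Ω) :
    ∫ w in Ω, ρ (w - z) • f w = f z := by
  have hmean : ∀ w, ‖w‖ ≤ r → Real.circleAverage (fun c => f (z + c • w)) 0 1 = f z :=
    fun w hw => circleAverage_eq_of_differentiableOn_lines (U := Ω)
      (fun y v => hf.comp (by fun_prop) (mapsTo_preimage _ _)) fun c hc => hz (by
        simpa [norm_smul] using (mul_le_of_le_one_left (norm_nonneg w) hc).trans hw)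
  calc ∫ w in Ω, ρ (w - z) • f w = ∫ w, ρ (w - z) • f w := by
        refine setIntegral_eq_integral_of_forall_compl_eq_zero fun w hw => ?_
        rw [hρ.eq_zero (lt_of_not_ge fun h => hw (hz (by simpa [dist_eq_norm] using h))), zero_smul]
    _ = ∫ w, ρ w • f (z + w) := by
        rw [← integral_add_left_eq_self (fun w => ρ (w - z) • f w) z]
        simp only [add_sub_cancel_left]
    _ = f z := hρ.integral_smul_eq_of_circleAverage_eq (hf.continuousOn.mono hz) hmean

/-- The vector `e` represents the evaluation at `z` of the holomorphic functions in `L²(Ω)`; it need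
not be holomorphic itself. -/
def RepresentsEval (z : Fin n → ℂ) (e : Lp ℂ 2 (volume.restrict Ω)) : Prop :=
  ∀ (g : Lp ℂ 2 (volume.restrict Ω)) (f : (Fin n → ℂ) → ℂ), DifferentiableOn ℂ f Ω →
    g =ᵐ[volume.restrict Ω] f → inner ℂ e g = f z

theorem exists_representsEval_norm_le (Ω : Set (Fin n → ℂ)) {r : ℝ} (hr : 0 < r) :
    ∃ C, ∀ z, Metric.closedBall z r ⊆ Ω →
      ∃ e : Lp ℂ 2 (volume.restrict Ω), RepresentsEval z e ∧ ‖e‖ ≤ C := by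
  obtain ⟨ρ, hρ⟩ := exists_isCircularMollifier (n := n) hr
  set φ : (Fin n → ℂ) → ℂ := fun w => ρ w
  have hφ : MemLp φ 2 volume :=
    (Complex.continuous_ofReal.comp hρ.contDiff.continuous).memLp_of_hasCompactSupport
      (hρ.hasCompactSupport.comp_left Complex.ofReal_zero)
  refine ⟨(eLpNorm φ 2 volume).toReal, fun z hz => ?_⟩
  have hpres : MeasurePreserving (fun w : Fin n → ℂ => w - z) volume volume :=
    measurePreserving_sub_right volume z
  have hφz : MemLp (φ ∘ fun w => w - z) 2 (volume.restrict Ω) :=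
    (hφ.comp_measurePreserving hpres).restrict Ω
  refine ⟨hφz.toLp _, fun g f hf hg => ?_, ?_⟩
  · rw [← hρ.setIntegral_sub_smul_eq hf hz, L2.inner_def]
    refine integral_congr_ae ?_
    filter_upwards [hg, hφz.coeFn_toLp] with w hgw hφw
    simp [hgw, hφw, φ, mul_comm]
  · rw [Lp.norm_toLp]
    exact ENNReal.toReal_mono hφ.eLpNorm_ne_top ((eLpNorm_restrict_le _ _ _ _).trans_eq
      (eLpNorm_comp_measurePreserving hφ.aestronglyMeasurable hpres))

theorem exists_eventually_norm_eval_le (hΩ : IsOpen Ω) {z : Fin n → ℂ} (hz : z ∈ Ω) :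
    ∃ C, ∀ᶠ y in 𝓝 z, ∀ (g : Lp ℂ 2 (volume.restrict Ω)) (f : (Fin n → ℂ) → ℂ),
      DifferentiableOn ℂ f Ω → g =ᵐ[volume.restrict Ω] f → ‖f y‖ ≤ C * ‖g‖ := by
  obtain ⟨r, hr, hev⟩ := exists_eventually_closedBall_subset (hΩ.mem_nhds hz)
  obtain ⟨C, hC⟩ := exists_representsEval_norm_le Ω hr
  refine ⟨C, hev.mono fun y hy g f hf hg => ?_⟩
  obtain ⟨e, he, heC⟩ := hC y hy
  rw [← he g f hf hg]
  exact (norm_inner_le_norm e g).trans (by gcongr)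

theorem exists_representsEval (hΩ : IsOpen Ω) :
    ∃ e : (Fin n → ℂ) → Lp ℂ 2 (volume.restrict Ω), ∀ z ∈ Ω, RepresentsEval z (e z) := by
  have hex : ∀ z ∈ Ω, ∃ e : Lp ℂ 2 (volume.restrict Ω), RepresentsEval z e := by
    intro z hz
    obtain ⟨r, hr, hrΩ⟩ := Metric.nhds_basis_closedBall.mem_iff.1 (hΩ.mem_nhds hz)
    obtain ⟨C, hC⟩ := exists_representsEval_norm_le Ω hr
    obtain ⟨e, he, -⟩ := hC z hrΩ
    exact ⟨e, he⟩
  choose! e he using hex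
  exact ⟨e, he⟩

theorem tendstoLocallyUniformlyOn_of_tendsto_Lp (hΩ : IsOpen Ω)
    {u : ℕ → Lp ℂ 2 (volume.restrict Ω)} {g : Lp ℂ 2 (volume.restrict Ω)}
    (hu : Tendsto u atTop (𝓝 g)) {f : ℕ → (Fin n → ℂ) → ℂ} {F : (Fin n → ℂ) → ℂ}
    (hf : ∀ m, DifferentiableOn ℂ (f m) Ω) (hfu : ∀ m, u m =ᵐ[volume.restrict Ω] f m)
    (hF : ∀ z ∈ Ω, Tendsto (fun m => f m z) atTop (𝓝 (F z))) :
    TendstoLocallyUniformlyOn f F atTop Ω := by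
  refine Metric.tendstoLocallyUniformlyOn_iff.2 fun ε hε z hz => ?_
  obtain ⟨C, hC⟩ := exists_eventually_norm_eval_le hΩ hz
  have hle : ∀ᶠ y in 𝓝 z, ∀ m, dist (F y) (f m y) ≤ C * ‖g - u m‖ := by
    filter_upwards [hC, hΩ.mem_nhds hz] with y hy hyΩ m
    rw [dist_eq_norm]
    refine le_of_tendsto_of_tendsto' ((hF y hyΩ).sub_const (f m y)).norm
      ((hu.sub_const (u m)).norm.const_mul C) fun l => ?_
    exact hy (u l - u m) (f l - f m) ((hf l).sub (hf m))
      ((Lp.coeFn_sub _ _).trans ((hfu l).sub (hfu m)))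
  have hzero : Tendsto (fun m => C * ‖g - u m‖) atTop (𝓝 0) := by
    simpa using (hu.const_sub g).norm.const_mul C
  refine ⟨_, mem_nhdsWithin_of_mem_nhds hle, ?_⟩
  filter_upwards [hzero.eventually_lt_const hε] with m hm y hy
  exact (hy m).trans_lt hm

theorem isClosed_bergmanSpace (hΩ : IsOpen Ω) :
    IsClosed (bergmanSpace Ω : Set (Lp ℂ 2 (volume.restrict Ω))) := by
  refine isClosed_of_closure_subset fun g hg => ?_
  obtain ⟨u, hu, hlim⟩ := mem_closure_iff_seq_limit.1 hg
  choose f hf hfu using hu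
  obtain ⟨e, he⟩ := exists_representsEval hΩ
  have hpt : ∀ z ∈ Ω, Tendsto (fun m => f m z) atTop (𝓝 (inner ℂ (e z) g)) := fun z hz =>
    (tendsto_const_nhds.inner hlim).congr fun m => he z hz (u m) (f m) (hf m) (hfu m)
  refine ⟨fun z => inner ℂ (e z) g, differentiableOn_of_tendstoLocallyUniformlyOn hΩ
    (tendstoLocallyUniformlyOn_of_tendsto_Lp hΩ hlim hf hfu hpt) (Eventually.of_forall hf), ?_⟩
  obtain ⟨s, hs, hae⟩ := (tendstoInMeasure_of_tendsto_Lp hlim).exists_seq_tendsto_ae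
  filter_upwards [hae, ae_all_iff.2 hfu, ae_restrict_mem hΩ.measurableSet] with w hw hfw hwΩ
  exact tendsto_nhds_unique hw
    (((hpt w hwΩ).comp hs.tendsto_atTop).congr fun i => (hfw (s i)).symm)

/-- A realization of the space of square-integrable holomorphic functions as a Hilbert space `H`
together with the vectors `k z` that represent the evaluations. -/
structure IsKernelModel (Ω : Set (Fin n → ℂ)) {H : Type*} [NormedAddCommGroup H]
    [InnerProductSpace ℂ H] (k : (Fin n → ℂ) → H) : Prop where
  isL2Holomorphic : ∀ g, IsL2Holomorphic Ω fun z => inner ℂ (k z) g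
  l2Inner_eq : ∀ g g', l2Inner Ω (fun z => inner ℂ (k z) g) (fun z => inner ℂ (k z) g') =
    inner ℂ g' g
  exists_eq : ∀ f, IsL2Holomorphic Ω f → ∃ g, ∀ z ∈ Ω, inner ℂ (k z) g = f z

theorem exists_isKernelModel (hΩ : IsOpen Ω) :
    ∃ k : (Fin n → ℂ) → bergmanSpace Ω, IsKernelModel Ω k := by
  have : CompleteSpace (bergmanSpace Ω) := (isClosed_bergmanSpace hΩ).completeSpace_coe
  obtain ⟨e, he⟩ := exists_representsEval hΩ
  set k : (Fin n → ℂ) → bergmanSpace Ω := fun z => (bergmanSpace Ω).orthogonalProjectionOnto (e z)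
  have hk : ∀ z ∈ Ω, ∀ (g : bergmanSpace Ω) (f : (Fin n → ℂ) → ℂ), DifferentiableOn ℂ f Ω →
      (g : Lp ℂ 2 (volume.restrict Ω)) =ᵐ[volume.restrict Ω] f → inner ℂ (k z) g = f z := by
    intro z hz g f hf hg
    rw [← he z hz g f hf hg]
    exact Submodule.inner_orthogonalProjectionOnto_eq_of_mem_right g (e z)
  have hae : ∀ g : bergmanSpace Ω,
      (g : Lp ℂ 2 (volume.restrict Ω)) =ᵐ[volume.restrict Ω] fun z => inner ℂ (k z) g := by
    rintro ⟨g, f, hf, hg⟩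
    filter_upwards [hg, ae_restrict_mem hΩ.measurableSet] with z hgz hz
    rw [hgz, hk z hz _ f hf hg]
  refine ⟨k, fun g => ⟨?_, (memLp_congr_ae (hae g)).1 (Lp.memLp g.1)⟩, fun g g' => ?_,
    fun f hf => ⟨⟨hf.2.toLp f, f, hf.1, hf.2.coeFn_toLp⟩,
      fun z hz => hk z hz _ f hf.1 hf.2.coeFn_toLp⟩⟩
  · obtain ⟨g, f, hf, hg⟩ := g
    exact hf.congr fun z hz => hk z hz _ f hf hg
  · rw [Submodule.coe_inner, L2.inner_def, l2Inner]
    refine integral_congr_ae ?_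
    filter_upwards [hae g, hae g'] with w hgw hgw'
    rw [hgw, hgw', RCLike.inner_apply]

end BergmanSpace

/-! ### The tensor `T̃` as a Fubini–Study form -/

section KernelJet

open scoped ContDiff

variable {n : ℕ} {Ω : Set (Fin n → ℂ)} {z : Fin n → ℂ}

theorem IsWedge.isAntiholomorphicAt_comp {ι V H E : Type*} [Fintype ι] [DecidableEq ι]
    [NormedAddCommGroup V] [NormedSpace ℂ V] [NormedAddCommGroup H] [InnerProductSpace ℂ H]
    [NormedAddCommGroup E] [InnerProductSpace ℂ E] {W : (ι → H) → E} (hW : IsWedge ℂ W)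
    {F : V → ι → H} {z : V} (hF : ∀ a, IsAntiholomorphicAt (fun w => F w a) z) :
    IsAntiholomorphicAt (fun w => W (F w)) z := by
  have hd : HasFDerivAt (fun w => W (F w)) _ z :=
    HasFDerivAt.multilinear_comp (hW.toContinuousMultilinearMap.restrictScalars ℝ) fun a =>
      (hF a).differentiableAt.hasFDerivAt
  refine ⟨hd.differentiableAt, fun X => ?_⟩
  rw [hd.fderiv]
  simp only [sum_apply, ContinuousLinearMap.comp_apply, fun a => (hF a).fderiv_I_smul X, map_neg,
    Finset.sum_neg_distrib, Finset.smul_sum, neg_inj]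
  exact Finset.sum_congr rfl fun a _ => hW.map_update_smul _ _ _ _

theorem l2Inner_congr (hΩ : IsOpen Ω) {f f' g g' : (Fin n → ℂ) → ℂ} (hf : EqOn f f' Ω)
    (hg : EqOn g g' Ω) : l2Inner Ω f g = l2Inner Ω f' g' :=
  setIntegral_congr_fun hΩ.measurableSet fun w hw => by simp only [hf hw, hg hw]

theorem isL2Holomorphic_of_isBounded (hΩ : IsOpen Ω) (hbdd : Bornology.IsBounded Ω)
    {f : (Fin n → ℂ) → ℂ} (hf : Differentiable ℂ f) : IsL2Holomorphic Ω f := by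
  have : IsFiniteMeasure (volume.restrict Ω) := ⟨by simpa using hbdd.measure_lt_top⟩
  obtain ⟨C, hC⟩ :=
    hbdd.isCompact_closure.exists_bound_of_continuousOn hf.continuous.continuousOn
  refine ⟨hf.differentiableOn, MemLp.of_bound hf.continuous.aestronglyMeasurable C ?_⟩
  filter_upwards [ae_restrict_mem hΩ.measurableSet] with w hw using hC w (subset_closure hw)

theorem jetMatrix_congr {f g : Fin (n + 1) → (Fin n → ℂ) → ℂ} (h : ∀ j, f j =ᶠ[𝓝 z] g j) :
    jetMatrix f z = jetMatrix g z := by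
  ext i j
  simp only [jetMatrix, Matrix.of_apply, (h j).eq_of_nhds, (h j).fderiv_eq]

theorem det_jetMatrix_coordinates (z : Fin n → ℂ) :
    (jetMatrix (Fin.cons (fun _ => 1) fun i w => w i) z).det = 1 := by
  have hder : ∀ i j : Fin n, fderiv ℂ (fun w : Fin n → ℂ => w j) z (Pi.single i 1) =
      if i = j then 1 else 0 := fun i j => by
    have hproj : HasFDerivAt (fun w : Fin n → ℂ => w j) (ContinuousLinearMap.proj (R := ℂ) j) z :=
      hasFDerivAt_apply j z
    simp [hproj.fderiv, Pi.single_apply, eq_comm]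
  have htri : (jetMatrix (Fin.cons (fun _ => 1) fun i w => w i) z).IsUpperTriangular := by
    intro a b hab
    induction a using Fin.cases with
    | zero => exact absurd hab (Fin.not_lt_zero _)
    | succ i =>
      induction b using Fin.cases with
      | zero => simp [jetMatrix]
      | succ j =>
        have hij : i ≠ j := fun h => by simp [h] at hab
        simp [jetMatrix, hder, hij]
  rw [Matrix.det_of_isUpperTriangular htri, Fin.prod_univ_succ]
  simp [jetMatrix, hder]

variable {H : Type*} [NormedAddCommGroup H] [InnerProductSpace ℂ H] {k : (Fin n → ℂ) → H}

/-- The `1`-jet of `k` at `z`: the value `k z` followed by the derivatives along the coordinate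
directions. If the vectors `k z` represent the evaluations, these vectors represent the evaluations
of the first partial derivatives. -/
def kernelJet (k : (Fin n → ℂ) → H) (z : Fin n → ℂ) : Fin (n + 1) → H :=
  Fin.cons (k z) fun i => fderiv ℝ k z (Pi.single i 1)

theorem contDiffAt_kernelJet (hk : ContDiffAt ℝ ∞ k z) : ContDiffAt ℝ ∞ (kernelJet k) z := by
  refine contDiffAt_pi.2 fun a => Fin.cases ?_ (fun i => ?_) a
  · simpa only [kernelJet, Fin.cons_zero] using hk
  · simpa only [kernelJet, Fin.cons_succ] using
      (hk.fderiv_right (m := ∞) le_rfl).clm_apply contDiffAt_const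

namespace IsKernelModel

theorem kernelDiag_eq (hk : IsKernelModel Ω k) (hΩ : IsOpen Ω) (hz : z ∈ Ω) :
    kernelDiag Ω z = ‖k z‖ ^ 2 := by
  have hex : ∃ f, IsReproducingAt Ω z f := by
    refine ⟨fun w => inner ℂ (k w) (k z), hk.isL2Holomorphic _, fun f hf => ?_⟩
    obtain ⟨g, hg⟩ := hk.exists_eq f hf
    rw [← hg z hz, ← hk.l2Inner_eq]
    exact l2Inner_congr hΩ (fun w hw => hg w hw) fun w _ => rfl
  obtain ⟨hhol, hrep⟩ := hex.choose_spec
  obtain ⟨g, hg⟩ := hk.exists_eq _ hhol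
  have hgk : g = k z := by
    refine ext_inner_right ℂ fun g' => ?_
    have hg' : inner ℂ (k z) g' = _ := hrep _ (hk.isL2Holomorphic g')
    rw [hg', ← hk.l2Inner_eq]
    exact l2Inner_congr hΩ (fun w _ => rfl) fun w hw => hg w hw
  rw [kernelDiag, bergmanKernel, dif_pos hex, ← hg z hz, hgk]
  exact inner_self_eq_norm_sq (𝕜 := ℂ) _

theorem ne_zero (hk : IsKernelModel Ω k) (hΩ : IsOpen Ω) (hbdd : Bornology.IsBounded Ω)
    (hz : z ∈ Ω) : k z ≠ 0 := by
  intro h0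
  obtain ⟨g, hg⟩ := hk.exists_eq (fun _ => 1) (isL2Holomorphic_of_isBounded hΩ hbdd (by fun_prop))
  have h01 := hg z hz
  rw [h0, inner_zero_left] at h01
  exact zero_ne_one h01

theorem bergmanMetric_eq (hk : IsKernelModel Ω k) (hΩ : IsOpen Ω) (hz : z ∈ Ω) :
    bergmanMetric Ω z = complexHessian (fun w => Real.log (‖k w‖ ^ 2)) z :=
  complexHessian_congr ((hΩ.eventually_mem hz).mono fun w hw => by
    simp only [hk.kernelDiag_eq hΩ hw])

variable [CompleteSpace H]

theorem contDiffAt (hk : IsKernelModel Ω k) (hΩ : IsOpen Ω) (hz : z ∈ Ω) : ContDiffAt ℝ ∞ k z :=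
  contDiffAt_of_differentiableOn_inner hΩ (fun g => (hk.isL2Holomorphic g).1) hz

theorem inner_fderiv_left (hk : IsKernelModel Ω k) (hΩ : IsOpen Ω) (hz : z ∈ Ω)
    (v : Fin n → ℂ) (g : H) :
    inner ℂ (fderiv ℝ k z v) g = fderiv ℂ (fun w => inner ℂ (k w) g) z v := by
  have hk' := (hk.contDiffAt hΩ hz).differentiableAt (by simp)
  have hd : DifferentiableAt ℂ (fun w => inner ℂ (k w) g) z :=
    (hk.isL2Holomorphic g).1.differentiableAt (hΩ.mem_nhds hz)
  have hreal := fderiv_inner_apply ℂ hk' (differentiableAt_const g) v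
  rw [hd.fderiv_restrictScalars ℝ] at hreal
  simpa using hreal.symm

theorem isAntiholomorphicAt (hk : IsKernelModel Ω k) (hΩ : IsOpen Ω) (hz : z ∈ Ω) :
    IsAntiholomorphicAt k z := by
  refine ⟨(hk.contDiffAt hΩ hz).differentiableAt (by simp), fun X => ext_inner_right ℂ fun g => ?_⟩
  rw [inner_neg_left, inner_smul_left, hk.inner_fderiv_left hΩ hz, hk.inner_fderiv_left hΩ hz,
    map_smul, Complex.conj_I, smul_eq_mul, neg_mul, neg_neg]

theorem isAntiholomorphicAt_kernelJet (hk : IsKernelModel Ω k) (hΩ : IsOpen Ω) (hz : z ∈ Ω)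
    (a : Fin (n + 1)) : IsAntiholomorphicAt (fun w => kernelJet k w a) z := by
  refine Fin.cases ?_ (fun i => ?_) a
  · simpa only [kernelJet, Fin.cons_zero] using hk.isAntiholomorphicAt hΩ hz
  · simpa only [kernelJet, Fin.cons_succ] using IsAntiholomorphicAt.fderiv_apply
      ((hk.contDiffAt hΩ hz).of_le ENat.LEInfty.out)
      ((hΩ.eventually_mem hz).mono fun w hw => hk.isAntiholomorphicAt hΩ hw) (Pi.single i 1)

variable {E : Type*} [NormedAddCommGroup E] [InnerProductSpace ℂ E] {W : (Fin (n + 1) → H) → E}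

theorem contDiffAt_wedge (hk : IsKernelModel Ω k) (hΩ : IsOpen Ω) (hW : IsWedge ℂ W)
    (hz : z ∈ Ω) : ContDiffAt ℝ ∞ (fun w => W (kernelJet k w)) z :=
  (hW.toContinuousMultilinearMap.restrictScalars ℝ).contDiff.contDiffAt.comp z
    (contDiffAt_kernelJet (hk.contDiffAt hΩ hz))

theorem isAntiholomorphicAt_wedge (hk : IsKernelModel Ω k) (hΩ : IsOpen Ω) (hW : IsWedge ℂ W)
    (hz : z ∈ Ω) : IsAntiholomorphicAt (fun w => W (kernelJet k w)) z :=
  hW.isAntiholomorphicAt_comp (hk.isAntiholomorphicAt_kernelJet hΩ hz)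

theorem det_jetMatrix (hk : IsKernelModel Ω k) (hΩ : IsOpen Ω) (hW : IsWedge ℂ W)
    (hz : z ∈ Ω) (g : Fin (n + 1) → H) :
    (jetMatrix (fun j w => inner ℂ (k w) (g j)) z).det = inner ℂ (W (kernelJet k z)) (W g) := by
  rw [hW]
  congr 1
  ext a j
  refine Fin.cases ?_ (fun i => ?_) a
  · simp only [jetMatrix, crossGram, kernelJet, Matrix.of_apply, Fin.cases_zero, Fin.cons_zero]
  · simp only [jetMatrix, crossGram, kernelJet, Matrix.of_apply, Fin.cases_succ, Fin.cons_succ,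
      hk.inner_fderiv_left hΩ hz]

theorem wedge_ne_zero (hk : IsKernelModel Ω k) (hΩ : IsOpen Ω) (hbdd : Bornology.IsBounded Ω)
    (hW : IsWedge ℂ W) (hz : z ∈ Ω) : W (kernelJet k z) ≠ 0 := by
  set f : Fin (n + 1) → (Fin n → ℂ) → ℂ := Fin.cons (fun _ => 1) fun i w => w i with hf
  have hex : ∀ j, ∃ g, ∀ w ∈ Ω, inner ℂ (k w) g = f j w := fun j => by
    refine hk.exists_eq _ (isL2Holomorphic_of_isBounded hΩ hbdd ?_)
    refine Fin.cases ?_ (fun i => ?_) j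
    · simp only [hf, Fin.cons_zero]; fun_prop
    · simp only [hf, Fin.cons_succ]; fun_prop
  choose g hg using hex
  have hdet : inner ℂ (W (kernelJet k z)) (W g) = 1 := by
    rw [← hk.det_jetMatrix hΩ hW hz, ← det_jetMatrix_coordinates z]
    exact congrArg Matrix.det (jetMatrix_congr fun j => (hΩ.eventually_mem hz).mono (hg j))
  intro h0
  rw [h0, inner_zero_left] at hdet
  exact zero_ne_one hdet

theorem kernelDiag_pow_mul_bergmanDet (hk : IsKernelModel Ω k) (hΩ : IsOpen Ω)
    (hbdd : Bornology.IsBounded Ω) (hW : IsWedge ℂ W) (hz : z ∈ Ω) :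
    kernelDiag Ω z ^ (n + 1) * bergmanDet Ω z = ‖W (kernelJet k z)‖ ^ 2 := by
  have hk0 := hk.ne_zero hΩ hbdd hz
  have hmetric : bergmanMetric Ω z = Matrix.of fun i j =>
      fsForm (k z) (fderiv ℝ k z (Pi.single i 1)) (fderiv ℝ k z (Pi.single j 1)) := by
    ext i j
    rw [hk.bergmanMetric_eq hΩ hz]
    exact complexHessian_log_norm_sq ((hk.contDiffAt hΩ hz).of_le ENat.LEInfty.out)
      ((hΩ.eventually_mem hz).mono fun w hw => hk.isAntiholomorphicAt hΩ hw) hk0 i j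
  have hinner : inner ℂ (k z) (k z) = ((kernelDiag Ω z : ℝ) : ℂ) := by
    rw [hk.kernelDiag_eq hΩ hz, inner_self_eq_norm_sq_to_K]; norm_cast
  have hnorm : ((‖W (kernelJet k z)‖ ^ 2 : ℝ) : ℂ) =
      ((kernelDiag Ω z ^ (n + 1) : ℝ) : ℂ) * (bergmanMetric Ω z).det := by
    rw [hmetric, Complex.ofReal_pow (kernelDiag Ω z), ← hinner, ← det_crossGram_cons hk0]
    exact hW.norm_sq _
  rw [bergmanDet, ← Complex.re_ofReal_mul, ← hnorm, Complex.ofReal_re]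

theorem log_bergmanDet_eq (hk : IsKernelModel Ω k) (hΩ : IsOpen Ω)
    (hbdd : Bornology.IsBounded Ω) (hW : IsWedge ℂ W) (hz : z ∈ Ω) :
    Real.log (bergmanDet Ω z) =
      Real.log (‖W (kernelJet k z)‖ ^ 2) - (n + 1 : ℕ) * Real.log (‖k z‖ ^ 2) := by
  have hk0 : ‖k z‖ ^ 2 ≠ 0 := pow_ne_zero _ (norm_ne_zero_iff.2 (hk.ne_zero hΩ hbdd hz))
  have hW0 : ‖W (kernelJet k z)‖ ^ 2 ≠ 0 :=
    pow_ne_zero _ (norm_ne_zero_iff.2 (hk.wedge_ne_zero hΩ hbdd hW hz))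
  rw [← hk.kernelDiag_pow_mul_bergmanDet hΩ hbdd hW hz, hk.kernelDiag_eq hΩ hz] at hW0 ⊢
  rw [Real.log_mul (pow_ne_zero _ hk0) (right_ne_zero_of_mul hW0), Real.log_pow]
  ring

theorem tildeMetric_eq (hk : IsKernelModel Ω k) (hΩ : IsOpen Ω)
    (hbdd : Bornology.IsBounded Ω) (hW : IsWedge ℂ W) (hz : z ∈ Ω) :
    tildeMetric Ω z = complexHessian (fun w => Real.log (‖W (kernelJet k w)‖ ^ 2)) z := by
  rw [tildeMetric, ricci, complexHessian_congr ((hΩ.eventually_mem hz).mono fun w hw =>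
      hk.log_bergmanDet_eq hΩ hbdd hW hw), complexHessian_sub_mul
    (contDiffAt_log_norm_sq ((hk.contDiffAt_wedge hΩ hW hz).of_le ENat.LEInfty.out)
      (hk.wedge_ne_zero hΩ hbdd hW hz))
    (contDiffAt_log_norm_sq ((hk.contDiffAt hΩ hz).of_le ENat.LEInfty.out)
      (hk.ne_zero hΩ hbdd hz)), hk.bergmanMetric_eq hΩ hz]
  push_cast
  abel

theorem tildeLength_eq (hk : IsKernelModel Ω k) (hΩ : IsOpen Ω)
    (hbdd : Bornology.IsBounded Ω) (hW : IsWedge ℂ W) (hz : z ∈ Ω) (X : Fin n → ℂ) :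
    tildeLength Ω z X =
      fsNorm (W (kernelJet k z)) (fderiv ℝ (fun w => W (kernelJet k w)) z X) := by
  rw [tildeLength, hk.tildeMetric_eq hΩ hbdd hW hz, sum_complexHessian_log_norm_sq
    ((hk.contDiffAt_wedge hΩ hW hz).of_le ENat.LEInfty.out)
    ((hΩ.eventually_mem hz).mono fun w hw => hk.isAntiholomorphicAt_wedge hΩ hW hw)
    (hk.wedge_ne_zero hΩ hbdd hW hz), Complex.ofReal_re, Real.sqrt_sq (fsNorm_nonneg _ _)]

end IsKernelModel

end KernelJet

/-! ### Curves and their lengths -/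

section Curves

theorem interval_induction {α : Type*} [LinearOrder α] (S : Finset α) {P : α → α → Prop}
    (piece : ∀ a b, a < b → (∀ t ∈ S, t ∉ Ioo a b) → P a b)
    (trans : ∀ a b c, a < b → b < c → P a b → P b c → P a c) {a b : α} (hab : a < b) : P a b := by
  induction S using Finset.induction_on generalizing a b with
  | empty => exact piece a b hab (by simp)
  | insert s S _ ih =>
    refine ih (fun a b hab hS => ?_) hab
    by_cases hs : s ∈ Ioo a b
    · refine trans a s b hs.1 hs.2 (piece a s hs.1 ?_) (piece s b hs.2 ?_)
      · exact Finset.forall_mem_insert _ _ _ |>.2 ⟨right_notMem_Ioo, fun t ht h =>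
          hS t ht (Ioo_subset_Ioo_right hs.2.le h)⟩
      · exact Finset.forall_mem_insert _ _ _ |>.2 ⟨left_notMem_Ioo, fun t ht h =>
          hS t ht (Ioo_subset_Ioo_left hs.1.le h)⟩
    · exact piece a b hab (Finset.forall_mem_insert _ _ _ |>.2 ⟨hs, hS⟩)

variable {n : ℕ} {Ω : Set (Fin n → ℂ)} {z ζ ξ : Fin n → ℂ} {γ γ₁ γ₂ : ℝ → Fin n → ℂ}

theorem IsCurve.induction (hγ : IsCurve Ω z ζ γ) {P : ℝ → ℝ → Prop}
    (piece : ∀ a b, 0 ≤ a → a < b → b ≤ 1 → ContDiffOn ℝ 1 γ (Icc a b) → P a b)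
    (trans : ∀ a b c, P a b → P b c → P a c) : P 0 1 := by
  obtain ⟨S, hS⟩ := hγ.piecewise
  refine interval_induction (P := fun a b => 0 ≤ a → b ≤ 1 → P a b) S
    (fun a b hab hSab ha hb => piece a b ha hab hb (hS a b ha hab hb hSab))
    (fun a b c hab hbc hPab hPbc ha hc => trans a b c (hPab ha (hbc.le.trans hc))
      (hPbc (ha.trans hab.le) hc)) zero_lt_one le_rfl le_rfl

/-- The length of a curve in `Ω` for the tensor `T̃`. -/
def curveLength (Ω : Set (Fin n → ℂ)) (γ : ℝ → Fin n → ℂ) : ℝ :=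
  ∫ t in (0 : ℝ)..1, tildeLength Ω (γ t) (deriv γ t)

theorem tildeLength_nonneg (w X : Fin n → ℂ) : 0 ≤ tildeLength Ω w X := Real.sqrt_nonneg _

theorem curveLength_nonneg : 0 ≤ curveLength Ω γ :=
  intervalIntegral.integral_nonneg zero_le_one fun _ _ => tildeLength_nonneg _ _

theorem tildeDist_nonneg : 0 ≤ tildeDist Ω z ζ :=
  Real.sInf_nonneg (by rintro _ ⟨γ, -, rfl⟩; exact curveLength_nonneg)

theorem IsCurve.tildeDist_le (hγ : IsCurve Ω z ζ γ) : tildeDist Ω z ζ ≤ curveLength Ω γ :=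
  csInf_le ⟨0, by rintro _ ⟨γ, -, rfl⟩; exact curveLength_nonneg⟩ ⟨γ, hγ, rfl⟩

theorem exists_curveLength_lt (h : ∃ γ, IsCurve Ω z ζ γ) {c : ℝ} (hc : tildeDist Ω z ζ < c) :
    ∃ γ, IsCurve Ω z ζ γ ∧ curveLength Ω γ < c := by
  obtain ⟨γ₀, hγ₀⟩ := h
  rw [tildeDist] at hc
  obtain ⟨_, ⟨γ, hγ, rfl⟩, hlt⟩ := exists_lt_of_csInf_lt (by exact ⟨_, γ₀, hγ₀, rfl⟩) hc
  exact ⟨γ, hγ, hlt⟩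

theorem tildeLength_smul (w X : Fin n → ℂ) (c : ℝ) :
    tildeLength Ω w (c • X) = |c| * tildeLength Ω w X := by
  have hsum : (∑ i, ∑ j, tildeMetric Ω w i j * (c • X) i * starRingEnd ℂ ((c • X) j)) =
      ((c ^ 2 : ℝ) : ℂ) * ∑ i, ∑ j, tildeMetric Ω w i j * X i * starRingEnd ℂ (X j) := by
    simp only [Finset.mul_sum]
    refine Finset.sum_congr rfl fun i _ => Finset.sum_congr rfl fun j _ => ?_
    simp only [Pi.smul_apply, Complex.real_smul, map_mul, Complex.conj_ofReal]
    push_cast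
    ring
  rw [tildeLength, hsum, Complex.re_ofReal_mul, Real.sqrt_mul (sq_nonneg c), Real.sqrt_sq_eq_abs,
    tildeLength]

/-- The curve `γ₁` followed by the curve `γ₂`, each of them at double speed. -/
def concat (γ₁ γ₂ : ℝ → Fin n → ℂ) (t : ℝ) : Fin n → ℂ :=
  if t ≤ 1 / 2 then γ₁ (2 * t) else γ₂ (2 * t - 1)

theorem eqOn_concat_left : EqOn (concat γ₁ γ₂) (fun t => γ₁ (2 * t)) (Iic (1 / 2)) :=
  fun _ ht => if_pos ht

theorem eqOn_concat_right (h : γ₁ 1 = γ₂ 0) :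
    EqOn (concat γ₁ γ₂) (fun t => γ₂ (2 * t - 1)) (Ici (1 / 2)) := by
  intro t ht
  rcases eq_or_lt_of_le (mem_Ici.1 ht) with rfl | hlt
  · norm_num [concat, h]
  · exact if_neg (not_le.2 hlt)

theorem contDiffOn_concat_left {m : WithTop ℕ∞} {a b : ℝ} (hb : b ≤ 1 / 2)
    (hγ₁ : ContDiffOn ℝ m γ₁ (Icc (2 * a) (2 * b))) :
    ContDiffOn ℝ m (concat γ₁ γ₂) (Icc a b) := by
  refine ContDiffOn.congr (hγ₁.comp (g := γ₁) (f := fun t => 2 * t) (by fun_prop) fun t ht => ?_)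
    (eqOn_concat_left.mono fun t ht => ht.2.trans hb)
  constructor <;> linarith [ht.1, ht.2]

theorem contDiffOn_concat_right {m : WithTop ℕ∞} (h : γ₁ 1 = γ₂ 0) {a b : ℝ} (ha : 1 / 2 ≤ a)
    (hγ₂ : ContDiffOn ℝ m γ₂ (Icc (2 * a - 1) (2 * b - 1))) :
    ContDiffOn ℝ m (concat γ₁ γ₂) (Icc a b) := by
  refine ContDiffOn.congr
    (hγ₂.comp (g := γ₂) (f := fun t => 2 * t - 1) (by fun_prop) fun t ht => ?_)
    ((eqOn_concat_right h).mono fun t ht => ha.trans ht.1)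
  constructor <;> linarith [ht.1, ht.2]

theorem continuousOn_concat (h : γ₁ 1 = γ₂ 0) (hγ₁ : ContinuousOn γ₁ (Icc 0 1))
    (hγ₂ : ContinuousOn γ₂ (Icc 0 1)) : ContinuousOn (concat γ₁ γ₂) (Icc 0 1) := by
  have hleft : ContinuousOn (concat γ₁ γ₂) (Icc 0 (1 / 2)) :=
    (contDiffOn_concat_left (m := 0) le_rfl (by norm_num [hγ₁])).continuousOn
  have hright : ContinuousOn (concat γ₁ γ₂) (Icc (1 / 2) 1) :=
    (contDiffOn_concat_right (m := 0) h le_rfl (by norm_num [hγ₂])).continuousOn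
  rw [← Icc_union_Icc_eq_Icc (by norm_num : (0 : ℝ) ≤ 1 / 2) (by norm_num : (1 / 2 : ℝ) ≤ 1)]
  exact hleft.union_of_isClosed hright isClosed_Icc isClosed_Icc

theorem mapsTo_concat (h : γ₁ 1 = γ₂ 0) (hγ₁ : MapsTo γ₁ (Icc 0 1) Ω)
    (hγ₂ : MapsTo γ₂ (Icc 0 1) Ω) : MapsTo (concat γ₁ γ₂) (Icc 0 1) Ω := by
  intro t ht
  rcases le_total t (1 / 2) with hle | hle
  · rw [eqOn_concat_left hle]
    exact hγ₁ ⟨by linarith [ht.1], by linarith⟩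
  · rw [eqOn_concat_right h hle]
    exact hγ₂ ⟨by linarith, by linarith [ht.2]⟩

theorem IsCurve.concat (h₁ : IsCurve Ω z ζ γ₁) (h₂ : IsCurve Ω ζ ξ γ₂) :
    IsCurve Ω z ξ (concat γ₁ γ₂) where
  continuousOn := continuousOn_concat (h₁.target.trans h₂.source.symm) h₁.continuousOn
    h₂.continuousOn
  piecewise := by
    obtain ⟨S₁, hS₁⟩ := h₁.piecewise
    obtain ⟨S₂, hS₂⟩ := h₂.piecewise
    refine ⟨insert (1 / 2) (S₁.image (fun t => t / 2) ∪ S₂.image fun t => (t + 1) / 2),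
      fun a b ha hab hb hS => ?_⟩
    simp only [Finset.forall_mem_insert, Finset.forall_mem_union, Finset.forall_mem_image] at hS
    obtain ⟨hhalf, hS₁', hS₂'⟩ := hS
    rcases le_or_gt b (1 / 2) with hb' | hb'
    · refine contDiffOn_concat_left hb' (hS₁ _ _ (by linarith) (by linarith) (by linarith) ?_)
      exact fun t ht hmem => hS₁' ht ⟨by linarith [hmem.1], by linarith [hmem.2]⟩
    · have ha' : 1 / 2 ≤ a := le_of_not_gt fun h => hhalf ⟨h, hb'⟩
      refine contDiffOn_concat_right (h₁.target.trans h₂.source.symm) ha'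
        (hS₂ _ _ (by linarith) (by linarith) (by linarith) ?_)
      exact fun t ht hmem => hS₂' ht ⟨by linarith [hmem.1], by linarith [hmem.2]⟩
  mapsTo := mapsTo_concat (h₁.target.trans h₂.source.symm) h₁.mapsTo h₂.mapsTo
  source := by norm_num [BergmanRicci.concat, h₁.source]
  target := by norm_num [BergmanRicci.concat, h₂.target]

theorem integral_tildeLength_concat_left :
    ∫ t in (0 : ℝ)..(1 / 2), tildeLength Ω (concat γ₁ γ₂ t) (deriv (concat γ₁ γ₂) t) =
      curveLength Ω γ₁ := by
  have hEq : EqOn (fun t => tildeLength Ω (concat γ₁ γ₂ t) (deriv (concat γ₁ γ₂) t))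
      (fun t => 2 * (fun s => tildeLength Ω (γ₁ s) (deriv γ₁ s)) (2 * t)) (Ioo 0 (1 / 2)) := by
    intro t ht
    have hev : concat γ₁ γ₂ =ᶠ[𝓝 t] fun t => γ₁ (2 * t) :=
      (eqOn_concat_left.mono Iio_subset_Iic_self).eventuallyEq_of_mem (Iio_mem_nhds ht.2)
    simp only [hev.deriv_eq, hev.eq_of_nhds, deriv_comp_mul_left, tildeLength_smul, Nat.abs_ofNat]
  rw [intervalIntegral.integral_congr_Ioo_of_le (by norm_num) hEq,
    intervalIntegral.integral_const_mul, intervalIntegral.mul_integral_comp_mul_left (c := 2)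
      (f := fun s => tildeLength Ω (γ₁ s) (deriv γ₁ s))]
  norm_num [curveLength]

theorem integral_tildeLength_concat_right (h : γ₁ 1 = γ₂ 0) :
    ∫ t in (1 / 2 : ℝ)..1, tildeLength Ω (concat γ₁ γ₂ t) (deriv (concat γ₁ γ₂) t) =
      curveLength Ω γ₂ := by
  have hEq : EqOn (fun t => tildeLength Ω (concat γ₁ γ₂ t) (deriv (concat γ₁ γ₂) t))
      (fun t => 2 * (fun s => tildeLength Ω (γ₂ s) (deriv γ₂ s)) (2 * t - 1)) (Ioo (1 / 2) 1) := by
    intro t ht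
    have hev : concat γ₁ γ₂ =ᶠ[𝓝 t] fun t => γ₂ (2 * t - 1) :=
      ((eqOn_concat_right h).mono Ioi_subset_Ici_self).eventuallyEq_of_mem (Ioi_mem_nhds ht.1)
    have hderiv : deriv (fun t => γ₂ (2 * t - 1)) t = (2 : ℝ) • deriv γ₂ (2 * t - 1) := by
      rw [deriv_comp_mul_left 2 (fun s => γ₂ (s - 1)), deriv_comp_sub_const]
    simp only [hev.deriv_eq, hev.eq_of_nhds, hderiv, tildeLength_smul, Nat.abs_ofNat]
  rw [intervalIntegral.integral_congr_Ioo_of_le (by norm_num) hEq,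
    intervalIntegral.integral_const_mul,
    intervalIntegral.mul_integral_comp_mul_sub (c := 2) (d := 1)
      (f := fun s => tildeLength Ω (γ₂ s) (deriv γ₂ s))]
  norm_num [curveLength]

theorem curveLength_concat (h : γ₁ 1 = γ₂ 0)
    (hint : IntervalIntegrable
      (fun t => tildeLength Ω (concat γ₁ γ₂ t) (deriv (concat γ₁ γ₂) t)) volume 0 1) :
    curveLength Ω (concat γ₁ γ₂) = curveLength Ω γ₁ + curveLength Ω γ₂ := by
  have hhalf : (1 / 2 : ℝ) ∈ uIcc 0 1 := by rw [uIcc_of_le zero_le_one]; norm_num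
  rw [curveLength, ← intervalIntegral.integral_add_adjacent_intervals
    (hint.mono_set (uIcc_subset_uIcc_left hhalf)) (hint.mono_set (uIcc_subset_uIcc_right hhalf)),
    integral_tildeLength_concat_left, integral_tildeLength_concat_right h]

theorem isCurve_lineMap {s : Set (Fin n → ℂ)} (hs : Convex ℝ s) (hsΩ : s ⊆ Ω) (hz : z ∈ s)
    (hζ : ζ ∈ s) : IsCurve Ω z ζ (AffineMap.lineMap z ζ) where
  continuousOn := AffineMap.lineMap_continuous.continuousOn
  piecewise := ⟨∅, fun a b _ _ _ _ => by
    have hsmooth : ContDiff ℝ 1 fun t : ℝ => AffineMap.lineMap z ζ t := by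
      simp only [AffineMap.lineMap_apply_module]
      fun_prop
    exact hsmooth.contDiffOn⟩
  mapsTo := fun t ht => hsΩ (hs.lineMap_mem hz hζ ht)
  source := AffineMap.lineMap_apply_zero _ _
  target := AffineMap.lineMap_apply_one _ _

theorem exists_isCurve (hΩ : IsOpen Ω) (hconn : IsPreconnected Ω) (hz : z ∈ Ω) (hζ : ζ ∈ Ω) :
    ∃ γ, IsCurve Ω z ζ γ := by
  refine hconn.induction₂' (fun z ζ => ∃ γ, IsCurve Ω z ζ γ) (fun x hx => ?_)
    (fun x y w _ _ _ ⟨γ₁, h₁⟩ ⟨γ₂, h₂⟩ => ⟨_, h₁.concat h₂⟩) hz hζ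
  obtain ⟨r, hr, hball⟩ := Metric.isOpen_iff.1 hΩ x hx
  filter_upwards [mem_nhdsWithin_of_mem_nhds (Metric.ball_mem_nhds x hr)] with y hy
  exact ⟨⟨_, isCurve_lineMap (convex_ball x r) hball (Metric.mem_ball_self hr) hy⟩,
    ⟨_, isCurve_lineMap (convex_ball x r) hball hy (Metric.mem_ball_self hr)⟩⟩

end Curves

/-! ### Lengths of curves and variation of projections -/

section Length

variable {n : ℕ} {E : Type*} [NormedAddCommGroup E] [InnerProductSpace ℂ E]

theorem continuousOn_fsNorm {α : Type*} [TopologicalSpace α] {x v : α → E} {s : Set α}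
    (hx : ContinuousOn x s) (hv : ContinuousOn v s) (h0 : ∀ t ∈ s, x t ≠ 0) :
    ContinuousOn (fun t => fsNorm (x t) (v t)) s := by
  simp only [fsNorm, starProjection_orthogonal_singleton]
  have hcoeff : ContinuousOn (fun t => inner ℂ (x t) (v t) / inner ℂ (x t) (x t)) s :=
    (hx.inner hv).div (hx.inner hx) fun t ht => inner_self_eq_zero.not.2 (h0 t ht)
  exact (hv.sub (hcoeff.smul hx)).norm.div hx.norm fun t ht => norm_ne_zero_iff.2 (h0 t ht)

theorem norm_starProjection_singleton_sub_le {x x' : ℝ → E} {a b : ℝ} (hab : a ≤ b)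
    (hx : ∀ t ∈ Icc a b, HasDerivWithinAt x (x' t) (Icc a b) t) (hx' : ContinuousOn x' (Icc a b))
    (h0 : ∀ t ∈ Icc a b, x t ≠ 0) (v : E) :
    ‖(ℂ ∙ x b).starProjection v - (ℂ ∙ x a).starProjection v‖ ≤
      2 * (∫ t in a..b, fsNorm (x t) (x' t)) * ‖v‖ := by
  have hproj := fun t ht => hasDerivWithinAt_starProjection_singleton (hx t ht) (h0 t ht) v
  have hint : IntervalIntegrable (fun t => fsNorm (x t) (x' t)) volume a b :=
    (continuousOn_fsNorm (fun t ht => (hx t ht).continuousWithinAt) hx'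
      h0).intervalIntegrable_of_Icc hab
  refine (norm_sub_le_integral_of_norm_deriv_le_of_le hab
    (B := fun t => 2 * fsNorm (x t) (x' t) * ‖v‖)
    (fun t ht => (hproj t ht).continuousWithinAt)
    (fun t ht => ((hproj t (Ioo_subset_Icc_self ht)).hasDerivAt
      (Icc_mem_nhds ht.1 ht.2)).differentiableAt.differentiableWithinAt)
    (.of_forall fun t ht => ?_) ((hint.const_mul 2).mul_const _)).trans_eq ?_
  · rw [((hproj t (Ioo_subset_Icc_self ht)).hasDerivAt (Icc_mem_nhds ht.1 ht.2)).deriv]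
    exact norm_deriv_starProjection_singleton_le _ _
  · rw [intervalIntegral.integral_mul_const, intervalIntegral.integral_const_mul]

variable {Ω : Set (Fin n → ℂ)} {Φ : (Fin n → ℂ) → E} {z ζ ξ p : Fin n → ℂ}
  {γ : ℝ → Fin n → ℂ} {a b : ℝ}

/-- A map `Φ` from `Ω` to the nonzero vectors of `E` such that the length of `T̃` is the pullback
of the Fubini–Study length under the map `[Φ]` to projective space. -/
structure IsFubiniStudyMap (Ω : Set (Fin n → ℂ)) (Φ : (Fin n → ℂ) → E) : Prop where
  contDiffAt : ∀ z ∈ Ω, ContDiffAt ℝ 2 Φ z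
  ne_zero : ∀ z ∈ Ω, Φ z ≠ 0
  tildeLength_eq : ∀ z ∈ Ω, ∀ X, tildeLength Ω z X = fsNorm (Φ z) (fderiv ℝ Φ z X)

namespace IsFubiniStudyMap

theorem continuousOn_fderiv (hΦ : IsFubiniStudyMap Ω Φ) : ContinuousOn (fderiv ℝ Φ) Ω :=
  fun z hz => ((hΦ.contDiffAt z hz).fderiv_right (m := 1)
    (by norm_num)).continuousAt.continuousWithinAt

theorem continuousOn_fderiv_derivWithin (hΦ : IsFubiniStudyMap Ω Φ) (hab : a < b)
    (hγ : ContDiffOn ℝ 1 γ (Icc a b)) (hmaps : MapsTo γ (Icc a b) Ω) :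
    ContinuousOn (fun t => fderiv ℝ Φ (γ t) (derivWithin γ (Icc a b) t)) (Icc a b) :=
  (hΦ.continuousOn_fderiv.comp hγ.continuousOn hmaps).clm_apply
    (hγ.continuousOn_derivWithin (uniqueDiffOn_Icc hab) le_rfl)

theorem eqOn_tildeLength (hΦ : IsFubiniStudyMap Ω Φ) (hmaps : MapsTo γ (Icc a b) Ω) :
    EqOn (fun t => tildeLength Ω (γ t) (deriv γ t))
      (fun t => fsNorm (Φ (γ t)) (fderiv ℝ Φ (γ t) (derivWithin γ (Icc a b) t))) (Ioo a b) :=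
  fun t ht => by
    simp only [hΦ.tildeLength_eq _ (hmaps (Ioo_subset_Icc_self ht)),
      derivWithin_of_mem_nhds (Icc_mem_nhds ht.1 ht.2)]

theorem intervalIntegrable_of_contDiffOn (hΦ : IsFubiniStudyMap Ω Φ) (hab : a < b)
    (hγ : ContDiffOn ℝ 1 γ (Icc a b)) (hmaps : MapsTo γ (Icc a b) Ω) :
    IntervalIntegrable (fun t => tildeLength Ω (γ t) (deriv γ t)) volume a b := by
  have hx : ContinuousOn (fun t => Φ (γ t)) (Icc a b) := fun t ht =>
    (hΦ.contDiffAt _ (hmaps ht)).continuousAt.comp_continuousWithinAt (hγ.continuousOn t ht)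
  have hint := (continuousOn_fsNorm hx (hΦ.continuousOn_fderiv_derivWithin hab hγ hmaps)
    fun t ht => hΦ.ne_zero _ (hmaps ht)).intervalIntegrable_of_Icc (μ := volume) hab.le
  rw [intervalIntegrable_iff_integrableOn_Ioo_of_le hab.le] at hint ⊢
  exact hint.congr_fun (hΦ.eqOn_tildeLength hmaps).symm measurableSet_Ioo

theorem norm_starProjection_sub_le_of_contDiffOn (hΦ : IsFubiniStudyMap Ω Φ) (hab : a < b)
    (hγ : ContDiffOn ℝ 1 γ (Icc a b)) (hmaps : MapsTo γ (Icc a b) Ω) (v : E) :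
    ‖(ℂ ∙ Φ (γ b)).starProjection v - (ℂ ∙ Φ (γ a)).starProjection v‖ ≤
      2 * (∫ t in a..b, tildeLength Ω (γ t) (deriv γ t)) * ‖v‖ := by
  rw [intervalIntegral.integral_congr_Ioo_of_le hab.le (hΦ.eqOn_tildeLength hmaps)]
  refine norm_starProjection_singleton_sub_le (x := fun t => Φ (γ t)) hab.le (fun t ht => ?_)
    (hΦ.continuousOn_fderiv_derivWithin hab hγ hmaps) (fun t ht => hΦ.ne_zero _ (hmaps ht)) v
  exact ((hΦ.contDiffAt _ (hmaps ht)).differentiableAt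
    two_ne_zero).hasFDerivAt.comp_hasDerivWithinAt t
      (hγ.differentiableOn one_ne_zero t ht).hasDerivWithinAt

theorem intervalIntegrable (hΦ : IsFubiniStudyMap Ω Φ) (hγ : IsCurve Ω z ζ γ) :
    IntervalIntegrable (fun t => tildeLength Ω (γ t) (deriv γ t)) volume 0 1 :=
  hγ.induction (fun _ _ ha hab hb h => hΦ.intervalIntegrable_of_contDiffOn hab h
    (hγ.mapsTo.mono_left (Icc_subset_Icc ha hb))) fun _ _ _ => IntervalIntegrable.trans

theorem norm_starProjection_sub_le_curveLength (hΦ : IsFubiniStudyMap Ω Φ)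
    (hγ : IsCurve Ω z ζ γ) (v : E) :
    ‖(ℂ ∙ Φ ζ).starProjection v - (ℂ ∙ Φ z).starProjection v‖ ≤
      2 * curveLength Ω γ * ‖v‖ := by
  let P := fun t => (ℂ ∙ Φ (γ t)).starProjection v
  let ℓ := fun t => tildeLength Ω (γ t) (deriv γ t)
  suffices h : IntervalIntegrable ℓ volume 0 1 ∧ ‖P 1 - P 0‖ ≤ 2 * (∫ t in (0 : ℝ)..1, ℓ t) * ‖v‖ by
    rw [← hγ.source, ← hγ.target]
    exact h.2
  refine hγ.induction (P := fun a b => IntervalIntegrable ℓ volume a b ∧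
    ‖P b - P a‖ ≤ 2 * (∫ t in a..b, ℓ t) * ‖v‖) (fun a b ha hab hb h => ?_) ?_
  · have hmaps := hγ.mapsTo.mono_left (Icc_subset_Icc ha hb)
    exact ⟨hΦ.intervalIntegrable_of_contDiffOn hab h hmaps,
      hΦ.norm_starProjection_sub_le_of_contDiffOn hab h hmaps v⟩
  · rintro a b c ⟨hint₁, hle₁⟩ ⟨hint₂, hle₂⟩
    refine ⟨hint₁.trans hint₂, (norm_sub_le_norm_sub_add_norm_sub _ (P b) _).trans ?_⟩
    rw [← intervalIntegral.integral_add_adjacent_intervals hint₁ hint₂]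
    linarith

theorem norm_starProjection_sub_le (hΦ : IsFubiniStudyMap Ω Φ) (hΩ : IsOpen Ω)
    (hconn : IsPreconnected Ω) (hz : z ∈ Ω) (hζ : ζ ∈ Ω) (v : E) :
    ‖(ℂ ∙ Φ ζ).starProjection v - (ℂ ∙ Φ z).starProjection v‖ ≤
      2 * tildeDist Ω z ζ * ‖v‖ := by
  have hle : ∀ c > tildeDist Ω z ζ,
      ‖(ℂ ∙ Φ ζ).starProjection v - (ℂ ∙ Φ z).starProjection v‖ ≤ 2 * c * ‖v‖ := by
    intro c hc
    obtain ⟨γ, hγ, hlt⟩ := exists_curveLength_lt (exists_isCurve hΩ hconn hz hζ) hc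
    refine (hΦ.norm_starProjection_sub_le_curveLength hγ v).trans ?_
    gcongr
  have hlim : Tendsto (fun c => 2 * c * ‖v‖) (𝓝[>] tildeDist Ω z ζ)
      (𝓝 (2 * tildeDist Ω z ζ * ‖v‖)) :=
    (Continuous.tendsto (by fun_prop) _).mono_left nhdsWithin_le_nhds
  exact ge_of_tendsto hlim (eventually_mem_nhdsWithin.mono hle)

theorem tildeDist_triangle (hΦ : IsFubiniStudyMap Ω Φ) (hΩ : IsOpen Ω)
    (hconn : IsPreconnected Ω) (hz : z ∈ Ω) (hζ : ζ ∈ Ω) (hξ : ξ ∈ Ω) :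
    tildeDist Ω z ξ ≤ tildeDist Ω z ζ + tildeDist Ω ζ ξ := by
  refine le_of_forall_pos_lt_add fun ε hε => ?_
  obtain ⟨γ₁, h₁, hlt₁⟩ := exists_curveLength_lt (exists_isCurve hΩ hconn hz hζ)
    (lt_add_of_pos_right (tildeDist Ω z ζ) (half_pos hε))
  obtain ⟨γ₂, h₂, hlt₂⟩ := exists_curveLength_lt (exists_isCurve hΩ hconn hζ hξ)
    (lt_add_of_pos_right (tildeDist Ω ζ ξ) (half_pos hε))
  have hle := (h₁.concat h₂).tildeDist_le
  rw [curveLength_concat (h₁.target.trans h₂.source.symm)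
    (hΦ.intervalIntegrable (h₁.concat h₂))] at hle
  linarith

theorem exists_eventually_tildeLength_le (hΦ : IsFubiniStudyMap Ω Φ) (hΩ : IsOpen Ω)
    (hp : p ∈ Ω) : ∃ C, ∀ᶠ w in 𝓝 p, ∀ X, tildeLength Ω w X ≤ C * ‖X‖ := by
  have hcont : ContinuousAt (fun w => ‖fderiv ℝ Φ w‖ / ‖Φ w‖) p :=
    (hΦ.continuousOn_fderiv.continuousAt (hΩ.mem_nhds hp)).norm.div
      (hΦ.contDiffAt p hp).continuousAt.norm (norm_ne_zero_iff.2 (hΦ.ne_zero p hp))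
  refine ⟨‖fderiv ℝ Φ p‖ / ‖Φ p‖ + 1, ?_⟩
  filter_upwards [hΩ.eventually_mem hp, hcont.eventually_le_const (lt_add_one _)] with w hw hle X
  calc tildeLength Ω w X ≤ ‖fderiv ℝ Φ w X‖ / ‖Φ w‖ := (hΦ.tildeLength_eq w hw X).trans_le
        (fsNorm_le _ _)
    _ ≤ ‖fderiv ℝ Φ w‖ * ‖X‖ / ‖Φ w‖ := by gcongr; exact ContinuousLinearMap.le_opNorm _ _
    _ = ‖fderiv ℝ Φ w‖ / ‖Φ w‖ * ‖X‖ := by ring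
    _ ≤ _ := by gcongr

end IsFubiniStudyMap

theorem tildeDist_le_of_convex {s : Set (Fin n → ℂ)} (hs : Convex ℝ s) (hsΩ : s ⊆ Ω) {C : ℝ}
    (hC : ∀ w ∈ s, ∀ X, tildeLength Ω w X ≤ C * ‖X‖) (hz : z ∈ s) (hζ : ζ ∈ s) :
    tildeDist Ω z ζ ≤ C * ‖ζ - z‖ := by
  refine (isCurve_lineMap hs hsΩ hz hζ).tildeDist_le.trans ((le_abs_self _).trans ?_)
  have hbound : ∀ t ∈ uIoc (0 : ℝ) 1, ‖tildeLength Ω (AffineMap.lineMap z ζ t)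
      (deriv (AffineMap.lineMap z ζ) t)‖ ≤ C * ‖ζ - z‖ := by
    intro t ht
    rw [uIoc_of_le zero_le_one] at ht
    rw [Real.norm_of_nonneg (tildeLength_nonneg _ _), AffineMap.hasDerivAt_lineMap.deriv]
    exact hC _ (hs.lineMap_mem hz hζ (Ioc_subset_Icc_self ht)) _
  simpa [curveLength] using intervalIntegral.norm_integral_le_of_norm_le_const hbound

theorem IsFubiniStudyMap.tendsto_tildeDist (hΦ : IsFubiniStudyMap Ω Φ) (hΩ : IsOpen Ω)
    (hp : p ∈ Ω) : Tendsto (fun z => tildeDist Ω z p) (𝓝 p) (𝓝 0) := by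
  obtain ⟨C, hC⟩ := hΦ.exists_eventually_tildeLength_le hΩ hp
  obtain ⟨r, hr, hball⟩ := Metric.eventually_nhds_iff_ball.1 ((hΩ.eventually_mem hp).and hC)
  have hlim : Tendsto (fun z => C * ‖p - z‖) (𝓝 p) (𝓝 0) :=
    Continuous.tendsto' (by fun_prop) _ _ (by simp)
  refine squeeze_zero' (.of_forall fun _ => tildeDist_nonneg) ?_ hlim
  filter_upwards [Metric.ball_mem_nhds p hr] with z hz
  exact tildeDist_le_of_convex (convex_ball p r) (fun w hw => (hball w hw).1)
    (fun w hw => (hball w hw).2) hz (Metric.mem_ball_self hr)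

end Length

/-! ### Completeness -/

section Completeness

variable {n : ℕ} {H E : Type*} [NormedAddCommGroup H] [InnerProductSpace ℂ H]
  [NormedAddCommGroup E] [InnerProductSpace ℂ E] {Ω : Set (Fin n → ℂ)} {Φ : (Fin n → ℂ) → E}
  {k : (Fin n → ℂ) → H} {W : (Fin (n + 1) → H) → E} {u : ℕ → Fin n → ℂ} {p : Fin n → ℂ}
  {g : Fin (n + 1) → H}

/-- A sequence of points of `Ω` that is Cauchy for the distance of `T̃`. -/
structure IsTildeCauchy (Ω : Set (Fin n → ℂ)) (u : ℕ → Fin n → ℂ) : Prop where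
  mem : ∀ m, u m ∈ Ω
  exists_tildeDist_lt : ∀ ε > 0, ∃ N, ∀ k ≥ N, ∀ l ≥ N, tildeDist Ω (u k) (u l) < ε

namespace IsFubiniStudyMap

theorem cauchySeq_starProjection (hΦ : IsFubiniStudyMap Ω Φ) (hΩ : IsOpen Ω)
    (hconn : IsPreconnected Ω) (hu : IsTildeCauchy Ω u) (v : E) :
    CauchySeq fun m => (ℂ ∙ Φ (u m)).starProjection v := by
  refine Metric.cauchySeq_iff.2 fun ε hε => ?_
  obtain ⟨N, hN⟩ := hu.exists_tildeDist_lt (ε / (2 * ‖v‖ + 1)) (by positivity)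
  refine ⟨N, fun l hl m hm => ?_⟩
  have hlt := hN m hm l hl
  rw [lt_div_iff₀ (by positivity)] at hlt
  have hle := hΦ.norm_starProjection_sub_le hΩ hconn (hu.mem m) (hu.mem l) v
  have hnonneg : 0 ≤ tildeDist Ω (u m) (u l) := tildeDist_nonneg
  rw [dist_eq_norm]
  linarith

theorem exists_half_norm_le_starProjection (hΦ : IsFubiniStudyMap Ω Φ) (hΩ : IsOpen Ω)
    (hconn : IsPreconnected Ω) (hu : IsTildeCauchy Ω u) :
    ∃ v : E, v ≠ 0 ∧ ∀ᶠ m in atTop, ‖v‖ / 2 ≤ ‖(ℂ ∙ Φ (u m)).starProjection v‖ := by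
  obtain ⟨N, hN⟩ := hu.exists_tildeDist_lt (1 / 4) (by norm_num)
  refine ⟨Φ (u N), hΦ.ne_zero _ (hu.mem N), (eventually_ge_atTop N).mono fun m hm => ?_⟩
  have hle := hΦ.norm_starProjection_sub_le hΩ hconn (hu.mem N) (hu.mem m) (Φ (u N))
  rw [Submodule.starProjection_eq_self_iff.2 (Submodule.mem_span_singleton_self _),
    norm_sub_rev] at hle
  have hsub := norm_sub_norm_le (Φ (u N)) ((ℂ ∙ Φ (u m)).starProjection (Φ (u N)))
  nlinarith [hN N le_rfl m hm, norm_nonneg (Φ (u N))]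

theorem exists_tendsto_starProjection [CompleteSpace E] (hΦ : IsFubiniStudyMap Ω Φ)
    (hΩ : IsOpen Ω) (hconn : IsPreconnected Ω) (hu : IsTildeCauchy Ω u) :
    ∃ v ω : E, ω ≠ 0 ∧ Tendsto (fun m => (ℂ ∙ Φ (u m)).starProjection v) atTop (𝓝 ω) ∧
      Tendsto (fun m => (ℂ ∙ Φ (u m)).starProjection ω) atTop (𝓝 ω) := by
  obtain ⟨v, hv, hge⟩ := hΦ.exists_half_norm_le_starProjection hΩ hconn hu
  obtain ⟨ω, hω⟩ := cauchySeq_tendsto_of_complete (hΦ.cauchySeq_starProjection hΩ hconn hu v)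
  have hnorm : ‖v‖ / 2 ≤ ‖ω‖ := ge_of_tendsto hω.norm hge
  refine ⟨v, ω, norm_pos_iff.1 ((half_pos (norm_pos_iff.2 hv)).trans_le hnorm), hω, ?_⟩
  have hdiff : Tendsto (fun m => (ℂ ∙ Φ (u m)).starProjection
      (ω - (ℂ ∙ Φ (u m)).starProjection v)) atTop (𝓝 0) := by
    refine squeeze_zero_norm (fun m => Submodule.norm_starProjection_apply_le _ _) ?_
    simpa using (hω.const_sub ω).norm
  have hidem : ∀ m, (ℂ ∙ Φ (u m)).starProjection ((ℂ ∙ Φ (u m)).starProjection v) =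
      (ℂ ∙ Φ (u m)).starProjection v := fun m =>
    Submodule.starProjection_eq_self_iff.2 (Submodule.starProjection_apply_mem _ _)
  simpa only [map_sub, hidem, sub_add_cancel, zero_add] using hdiff.add hω

theorem tendsto_tildeDist_of_subseq (hΦ : IsFubiniStudyMap Ω Φ) (hΩ : IsOpen Ω)
    (hconn : IsPreconnected Ω) (hu : IsTildeCauchy Ω u) (hp : p ∈ Ω) {φ : ℕ → ℕ}
    (hφ : StrictMono φ) (hlim : Tendsto (u ∘ φ) atTop (𝓝 p)) :
    Tendsto (fun m => tildeDist Ω (u m) p) atTop (𝓝 0) := by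
  refine Metric.tendsto_atTop.2 fun ε hε => ?_
  obtain ⟨N, hN⟩ := hu.exists_tildeDist_lt (ε / 2) (half_pos hε)
  obtain ⟨m, hm, hNm⟩ := ((((hΦ.tendsto_tildeDist hΩ hp).comp hlim).eventually_lt_const
    (half_pos hε)).and (eventually_ge_atTop N)).exists
  refine ⟨N, fun l hl => ?_⟩
  rw [Real.dist_0_eq_abs, abs_of_nonneg tildeDist_nonneg]
  calc tildeDist Ω (u l) p ≤ tildeDist Ω (u l) (u (φ m)) + tildeDist Ω (u (φ m)) p :=
        hΦ.tildeDist_triangle hΩ hconn (hu.mem l) (hu.mem _) hp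
    _ < ε / 2 + ε / 2 := add_lt_add (hN l hl (φ m) (hNm.trans (hφ.id_le m))) hm
    _ = ε := add_halves ε

end IsFubiniStudyMap

theorem IsWedge.exists_apply_eq_of_tendsto_starProjection [CompleteSpace H] [CompleteSpace E]
    (hW : IsWedge ℂ W) {h : ℕ → Fin (n + 1) → H} {v ω : E}
    (hω : Tendsto (fun m => (ℂ ∙ W (h m)).starProjection v) atTop (𝓝 ω)) : ∃ g, W g = ω := by
  refine hW.isClosed_range.mem_of_tendsto hω (.of_forall fun m => ?_)
  obtain ⟨c, hc⟩ := Submodule.mem_span_singleton.1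
    (Submodule.starProjection_apply_mem (ℂ ∙ W (h m)) v)
  exact ⟨Function.update (h m) 0 (c • h m 0), by
    rw [hW.map_update_smul, Function.update_eq_self, hc]⟩

namespace IsKernelModel

theorem gramDet_eq (hk : IsKernelModel Ω k) (hW : IsWedge ℂ W) (g : Fin (n + 1) → H) :
    gramDet Ω (fun j w => inner ℂ (k w) (g j)) = ‖W g‖ ^ 2 := by
  have hgram : (Matrix.of fun i j => l2Inner Ω (fun w => inner ℂ (k w) (g j))
      fun w => inner ℂ (k w) (g i)) = crossGram ℂ g g := by
    ext i j
    exact hk.l2Inner_eq _ _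
  rw [gramDet, hgram, ← hW.norm_sq]
  exact Complex.ofReal_re _

theorem eq_zero_of_forall_inner_eq_zero (hk : IsKernelModel Ω k) (hΩ : IsOpen Ω) {g : H}
    (h : ∀ z ∈ Ω, inner ℂ (k z) g = 0) : g = 0 := by
  rw [← inner_self_eq_zero (𝕜 := ℂ), ← hk.l2Inner_eq,
    l2Inner_congr (f' := fun _ => 0) (g' := fun _ => 0) hΩ h h]
  simp [l2Inner]

theorem linearIndependent_domRestrict (hk : IsKernelModel Ω k) (hΩ : IsOpen Ω)
    (hg : LinearIndependent ℂ g) :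
    LinearIndependent ℂ fun j => Ω.domRestrict fun w => inner ℂ (k w) (g j) := by
  rw [Fintype.linearIndependent_iff] at hg ⊢
  refine fun c hc => hg c (hk.eq_zero_of_forall_inner_eq_zero hΩ fun w hw => ?_)
  simpa [inner_sum, inner_smul_right, Finset.sum_apply] using congrFun hc ⟨w, hw⟩

variable [CompleteSpace H]

theorem isFubiniStudyMap (hk : IsKernelModel Ω k) (hΩ : IsOpen Ω)
    (hbdd : Bornology.IsBounded Ω) (hW : IsWedge ℂ W) :
    IsFubiniStudyMap Ω fun z => W (kernelJet k z) where
  contDiffAt _ hz := (hk.contDiffAt_wedge hΩ hW hz).of_le ENat.LEInfty.out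
  ne_zero _ hz := hk.wedge_ne_zero hΩ hbdd hW hz
  tildeLength_eq _ hz X := hk.tildeLength_eq hΩ hbdd hW hz X

theorem normSq_det_jetMatrix_div (hk : IsKernelModel Ω k) (hΩ : IsOpen Ω)
    (hbdd : Bornology.IsBounded Ω) (hW : IsWedge ℂ W) {z : Fin n → ℂ} (hz : z ∈ Ω)
    (g : Fin (n + 1) → H) :
    ‖(jetMatrix (fun j w => inner ℂ (k w) (g j)) z).det‖ ^ 2 /
        (kernelDiag Ω z ^ (n + 1) * bergmanDet Ω z) =
      ‖(ℂ ∙ W (kernelJet k z)).starProjection (W g)‖ ^ 2 := by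
  have hne : ‖W (kernelJet k z)‖ ≠ 0 := norm_ne_zero_iff.2 (hk.wedge_ne_zero hΩ hbdd hW hz)
  rw [hk.kernelDiag_pow_mul_bergmanDet hΩ hbdd hW hz, hk.det_jetMatrix hΩ hW hz,
    Submodule.starProjection_singleton, norm_smul, norm_div, RCLike.norm_ofReal,
    abs_of_nonneg (by positivity)]
  field_simp

theorem exists_tendsto_gramDet [CompleteSpace E] (hk : IsKernelModel Ω k) (hΩ : IsOpen Ω)
    (hconn : IsPreconnected Ω) (hbdd : Bornology.IsBounded Ω) (hW : IsWedge ℂ W)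
    (hu : IsTildeCauchy Ω u) :
    ∃ f : Fin (n + 1) → (Fin n → ℂ) → ℂ, (∀ j, IsL2Holomorphic Ω (f j)) ∧
      LinearIndependent ℂ (fun j => Ω.domRestrict (f j)) ∧
      Tendsto (fun m => ‖(jetMatrix f (u m)).det‖ ^ 2 /
        (kernelDiag Ω (u m) ^ (n + 1) * bergmanDet Ω (u m))) atTop (𝓝 (gramDet Ω f)) := by
  obtain ⟨v, ω, hω0, hω, hωω⟩ :=
    (hk.isFubiniStudyMap hΩ hbdd hW).exists_tendsto_starProjection hΩ hconn hu
  obtain ⟨g, rfl⟩ := hW.exists_apply_eq_of_tendsto_starProjection hω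
  refine ⟨fun j w => inner ℂ (k w) (g j), fun j => hk.isL2Holomorphic (g j),
    hk.linearIndependent_domRestrict hΩ (hW.linearIndependent hω0), ?_⟩
  simp only [hk.normSq_det_jetMatrix_div hΩ hbdd hW (hu.mem _), hk.gramDet_eq hW]
  exact hωω.norm.pow 2

end IsKernelModel

end Completeness

end BergmanRicci

end

theorem theorem2 (n : ℕ) (Ω : Set (Fin n → ℂ)) (hopen : IsOpen Ω) (hconn : IsConnected Ω)
    (hbdd : Bornology.IsBounded Ω)
    (hcrit : ∀ f : Fin (n + 1) → (Fin n → ℂ) → ℂ,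
      (∀ j, BergmanRicci.IsL2Holomorphic Ω (f j)) →
      LinearIndependent ℂ (fun j => Ω.domRestrict (f j)) →
      ∀ z₀ ∈ frontier Ω, ∀ z : ℕ → Fin n → ℂ, (∀ s, z s ∈ Ω) → Tendsto z atTop (𝓝 z₀) →
        ∃ φ : ℕ → ℕ, StrictMono φ ∧ ∃ L : ℝ,
          Tendsto (fun k => ‖(BergmanRicci.jetMatrix f (z (φ k))).det‖ ^ 2 /
            (BergmanRicci.kernelDiag Ω (z (φ k)) ^ (n + 1) *
              BergmanRicci.bergmanDet Ω (z (φ k)))) atTop (𝓝 L) ∧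
          L < BergmanRicci.gramDet Ω f) :
    BergmanRicci.TildeComplete Ω := by
  have : CompleteSpace (BergmanRicci.bergmanSpace Ω) :=
    (BergmanRicci.isClosed_bergmanSpace hopen).completeSpace_coe
  obtain ⟨k, hk⟩ := BergmanRicci.exists_isKernelModel hopen
  have hW := (BergmanRicci.isWedge_lpWedge (ι := Fin (n + 1)) (𝕜 := ℂ)
    (μ := volume.restrict Ω)).comp_linearIsometry (BergmanRicci.bergmanSpace Ω).subtypeₗᵢ
  intro u hmem hcauchy
  have hu : BergmanRicci.IsTildeCauchy Ω u := ⟨hmem, hcauchy⟩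
  obtain ⟨p, hp, φ, hφ, hlim⟩ := tendsto_subseq_of_bounded hbdd hmem
  by_cases hpΩ : p ∈ Ω
  · exact ⟨p, hpΩ, (hk.isFubiniStudyMap hopen hbdd hW).tendsto_tildeDist_of_subseq hopen
      hconn.isPreconnected hu hpΩ hφ hlim⟩
  · have hfr : p ∈ frontier Ω := hopen.frontier_eq ▸ ⟨hp, hpΩ⟩
    obtain ⟨f, hf, hfi, hgram⟩ :=
      hk.exists_tendsto_gramDet hopen hconn.isPreconnected hbdd hW hu
    obtain ⟨ψ, hψ, L, hL, hlt⟩ := hcrit f hf hfi p hfr (u ∘ φ) (fun _ => hmem _) hlim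
    exact absurd (tendsto_nhds_unique hL (hgram.comp (hφ.comp hψ).tendsto_atTop)) hlt.ne
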